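/- Consider a stochastic bandit with $N\ge 1$ arms and horizon $T$. Arm $a$ has a reward law with mean $\mu_a$ that is $1$-subGaussian, i.e. $\mathbb{E}\,e^{\lambda(r-\mu_a)}\le e^{\lambda^2/2}$ for all $\lambda\in\mathbb{R}$; rewards of all pulls are independent. Let $\Delta_a=\max_b\mu_b-\mu_a$. Fix constants $\rho\in(1/2,1)$ and $\alpha\ge 4$, and let $\log^+x=\max\{0,\log x\}$. The algorithm B-MOTS keeps, for each arm $a$, its number of pulls $k_a$, a level $\ell_a$ (initially $0$) and the number $n_a\le k_a$ of its rewards on which its current estimate is based. It first plays each arm once. In every later round $t$ it draws, independently for each arm and independently of everything else, $\tilde\theta_a(t)\sim\mathcal N\big(\hat\mu_{a,n_a},\tfrac{1}{\rho n_a}\big)$, where $\hat\mu_{a,s}$ is the average of the first $s$ rewards of arm $a$, clips it to $$\theta_a(t)=\min\Big\{\tilde\theta_a(t),\ \hat\mu_{a,n_a}+\sqrt{\tfrac{\alpha}{n_a}\log^+\tfrac{T}{N n_a}}\Big\},$$ and plays an arm $a(t)\in\arg\max_a\theta_a(t)$ (ties are broken by any fixed measurable rule). In every round, the initial ones included, the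 count of the played arm $a=a(t)$ is increased by one; if then $k_{a}=2^{\ell_{a}}$, the algorithm increases $\ell_{a}$ by one and queries the batch of pending pulls, after which the estimates are refreshed. Two refresh rules are allowed: either all pending rewards are used ($n_b:=k_b$ for all arms $b$), or only the estimate of the arm that triggered the query is refreshed ($n_a:=k_a$), so that $n_b$ is always the largest power of two not exceeding $k_b$. Then there is a constant $C$ depending only on $\rho$ and $\alpha$ such that, for either refresh rule and for all $N$, $T$ and all reward laws as above, the expected regret $\mathcal R(T)=\mathbb{E}\big[\sum_{t=1}^T\Delta_{a(t)}\big]$ satisfies $$\mathcal R(T)\le C\Big(\sqrt{NT}+\sum_{a=1}^N\Delta_a\Big);$$ in particular $\mathcal R(T)\le C\sqrt{NT}$ whenever $\Delta_a\le 1$ for all $a$. Moreover, the number of batch queries in $T$ rounds is always at most $N(\lfloor\log_2T\rfloor+1)=O(N\log T)$. -/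

import Mathlib

open MeasureTheory ProbabilityTheory

noncomputable section

namespace BMOTS

/-- Which estimates are refreshed when a batch is queried: those of all arms (every pending reward
is used), or only that of the arm whose pull count has just reached a power of two (so that the
estimate of an arm is always based on the largest power of two not exceeding its pull count). -/
inductive Refresh
  | all
  | trigger

/-- Average of the first `s` rewards of an arm. -/
def empMean (x : ℕ → ℝ) (s : ℕ) : ℝ := (∑ i ∈ Finset.range s, x i) / s

/-- The clipping level `μ̂ₛ + √((α / s) log⁺ (T / (s N)))`. -/
def clipLevel (N T : ℕ) (α : ℝ) (x : ℕ → ℝ) (s : ℕ) : ℝ :=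
  empMean x s + √(α / s * Real.posLog ((T : ℝ) / (s * N)))

/-- The clipped Gaussian sample: if `z` is standard normal, the first argument of `min` has law
`𝒩(μ̂ₛ, 1 / (ρ s))`. -/
def clippedSample (N T : ℕ) (ρ α : ℝ) (x : ℕ → ℝ) (s : ℕ) (z : ℝ) : ℝ :=
  min (empMean x s + z / √(ρ * s)) (clipLevel N T α x s)

/-- Counters kept by the algorithm. -/
structure State (N : ℕ) where
  /-- number of pulls of each arm so far -/
  pulls : Fin N → ℕ
  /-- the next batch query caused by arm `a` is made when its pull count reaches `2 ^ level a` -/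
  level : Fin N → ℕ
  /-- number of rewards of each arm on which its current estimate is based -/
  seen : Fin N → ℕ
  /-- number of batch queries so far -/
  batches : ℕ

/-- Parameters of the algorithm: horizon `T`, the constants `ρ` and `α`, a selection `argmax` of a
coordinate that maximizes a vector, and the refresh rule. -/
structure Params (N : ℕ) where
  T : ℕ
  ρ : ℝ
  α : ℝ
  argmax : (Fin N → ℝ) → Fin N
  refresh : Refresh

variable {N : ℕ}

/-- The arm played in round `t` (rounds are numbered from `0`). Each arm is played once first; then
the arm with the largest sample is played. `x a i` is the reward of the `(i+1)`-st pull of arm `a`,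
and `z t a` is the standard normal number used for arm `a` in round `t`. -/
def nextArm (p : Params N) (x : Fin N → ℕ → ℝ) (z : ℕ → Fin N → ℝ) (t : ℕ) (σ : State N) : Fin N :=
  if h : t < N then ⟨t, h⟩
  else p.argmax fun a => clippedSample N p.T p.ρ p.α (x a) (σ.seen a) (z t a)

/-- Update of the counters when arm `a` is played. -/
def State.play (r : Refresh) (σ : State N) (a : Fin N) : State N :=
  let k : Fin N → ℕ := Function.update σ.pulls a (σ.pulls a + 1)
  if k a < 2 ^ σ.level a then
    { σ with pulls := k }
  else
    { pulls := k
      level := Function.update σ.level a (σ.level a + 1)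
      seen := match r with
        | .all => k
        | .trigger => Function.update σ.seen a (k a)
      batches := σ.batches + 1 }

/-- The state before round `t`, i.e. after `t` rounds. -/
def state (p : Params N) (x : Fin N → ℕ → ℝ) (z : ℕ → Fin N → ℝ) : ℕ → State N
  | 0 => { pulls := fun _ => 0, level := fun _ => 0, seen := fun _ => 0, batches := 0 }
  | t + 1 => (state p x z t).play p.refresh (nextArm p x z t (state p x z t))

/-- The arm played in round `t`. -/
def arm (p : Params N) (x : Fin N → ℕ → ℝ) (z : ℕ → Fin N → ℝ) (t : ℕ) : Fin N :=
  nextArm p x z t (state p x z t)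

/-- Mean of arm `a`. -/
def mean (ν : Fin N → Measure ℝ) (a : Fin N) : ℝ := ∫ y, y ∂(ν a)

/-- Gap of arm `a`. -/
def gap (ν : Fin N → Measure ℝ) (a : Fin N) : ℝ := (⨆ b, mean ν b) - mean ν a

/-- Regret accumulated over the `T` rounds: `∑ₜ (max_b μ_b - μ_{a(t)})`. -/
def regret (p : Params N) (ν : Fin N → Measure ℝ) (x : Fin N → ℕ → ℝ) (z : ℕ → Fin N → ℝ) : ℝ :=
  ∑ t ∈ Finset.range p.T, gap ν (arm p x z t)

/-- A stochastic bandit together with the internal randomness of the algorithm: arm `a` yields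
i.i.d. rewards with law `ν a`, the numbers `Z t a` are standard normal, and everything is
independent. The laws `ν a` are `1`-subGaussian about their means. -/
structure IsModel {Ω : Type*} [MeasurableSpace Ω] (P : Measure Ω) (ν : Fin N → Measure ℝ)
    (X : Fin N → ℕ → Ω → ℝ) (Z : ℕ → Fin N → Ω → ℝ) : Prop where
  subgaussian : ∀ a, HasSubgaussianMGF (fun y => y - mean ν a) 1 (ν a)
  measurable_reward : ∀ a i, Measurable (X a i)
  measurable_noise : ∀ t a, Measurable (Z t a)
  law_reward : ∀ a i, HasLaw (X a i) (ν a) P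
  law_noise : ∀ t a, HasLaw (Z t a) (gaussianReal 0 1) P
  indep : iIndepFun (Sum.elim (fun q : Fin N × ℕ => X q.1 q.2) (fun q : ℕ × Fin N => Z q.1 q.2)) P

end BMOTS

end

/-!
Sub-Gaussian rewards satisfy the maximal inequality `P (∃ m ≤ n, x ≤ S m) ≤ exp (-x² / (2 n))`.
Applied along the powers of two, it shows that some clipping level of the best arm `s` falls by `δ`
below the mean of `s` with probability at most `24 N / (T δ²)`; this is where `4 ≤ α` enters. Summed
over `δ = 2 ^ j * d` with `d = √(N / T)`, this event costs `O(d)` per round.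

Let `i` be an arm of gap `2 δ` with `d ≤ δ`, and suppose that the levels of `s` stay above the
midpoint `y` of the two means. The noise of a round is independent of everything that determines
the state of the algorithm before it. So, given that state, playing `i` with a sample of at most
`y` is at most as likely as playing `s` times the odds that the sample of `s` is at most `y`. An
estimate is based on more than half of the pulls of its arm, hence the sum of these odds over the
plays of `s` is at most the sum over `k` of their maximum over `n ∈ (k / 2, k]`. As `ρ < 1`, the
inverse of the Gaussian tail grows more slowly than the deviations of the empirical mean of `s`
decay, and the sum is `O(1 / δ²)`. In a play of `i` with a sample above `y`, the clipping level of
`i` exceeds its mean by `δ`, which happens for `O((1 + log⁺ (T δ² / N)) / δ²)` counts `k` in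
expectation. So the arm `i` causes regret `O((1 + log⁺ (T δ² / N)) / δ) = O(1 / d)`, and all arms
together `O(N / d) = O(√(N T))`.

Every query raises one level by one, and `2 ^ (level - 1)` never exceeds the number of pulls, so
each arm triggers at most `log₂ T + 1` queries.
-/

open Filter Finset
open scoped ENNReal NNReal

namespace BMOTS

section Maximal

variable {Ω : Type*} [MeasurableSpace Ω] {P : Measure Ω} [IsProbabilityMeasure P]
  {c : ℝ≥0} {Y : ℕ → Ω → ℝ}

lemma one_add_mul_integral_le_mgf {U : Ω → ℝ} (hU : HasSubgaussianMGF U c P) (l : ℝ) :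
    1 + l * P[U] ≤ mgf U P l := by
  have hadd : 1 + l * P[U] = ∫ ω, (l * U ω + 1) ∂P := by
    rw [integral_add (hU.integrable.const_mul l) (integrable_const _), integral_const_mul]
    simp [add_comm]
  rw [hadd]
  exact integral_mono ((hU.integrable.const_mul l).add (integrable_const _))
    (hU.integrable_exp_mul l) fun ω => Real.add_one_le_exp _

lemma integral_eq_zero_of_hasSubgaussianMGF {U : Ω → ℝ} (hU : HasSubgaussianMGF U c P) :
    P[U] = 0 := by
  have hmin : IsLocalMin (fun l : ℝ => Real.exp (c * l ^ 2 / 2) - l * P[U]) 0 :=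
    Eventually.of_forall fun l => by
      have := (one_add_mul_integral_le_mgf hU l).trans (hU.mgf_le l)
      simp only [ne_eq, OfNat.ofNat_ne_zero, not_false_eq_true, zero_pow, mul_zero, zero_div,
        Real.exp_zero, zero_mul, sub_zero]
      linarith
  have hderiv : HasDerivAt (fun l : ℝ => Real.exp (c * l ^ 2 / 2) - l * P[U]) (-P[U]) 0 := by
    have h := ((((hasDerivAt_pow 2 (0 : ℝ)).const_mul (c : ℝ)).div_const 2).exp).fun_sub
      ((hasDerivAt_id (0 : ℝ)).mul_const P[U])
    simpa using h
  simpa using hmin.hasDerivAt_eq_zero hderiv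

lemma submartingale_exp_mul_sum (hY : ∀ i, StronglyMeasurable (Y i)) (hind : iIndepFun Y P)
    (hsub : ∀ i, HasSubgaussianMGF (Y i) c P) (l : ℝ) :
    Submartingale (fun n ω => Real.exp (l * ∑ i ∈ range (n + 1), Y i ω))
      (Filtration.natural Y hY) P := by
  have hadapted : StronglyAdapted (Filtration.natural Y hY)
      fun n ω => Real.exp (l * ∑ i ∈ range (n + 1), Y i ω) := fun n =>
    Real.continuous_exp.comp_stronglyMeasurable <| StronglyMeasurable.const_mul
      (Finset.stronglyMeasurable_fun_sum _ fun i hi =>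
        (Filtration.stronglyAdapted_natural hY).stronglyMeasurable_le
          (Nat.lt_succ_iff.1 (mem_range.1 hi))) l
  have hint : ∀ n, Integrable (fun ω => Real.exp (l * ∑ i ∈ range (n + 1), Y i ω)) P := fun n =>
    (HasSubgaussianMGF.sum_of_iIndepFun hind fun i _ => hsub i).integrable_exp_mul l
  refine submartingale_nat hadapted hint fun n => ?_
  have hsplit : (fun ω => Real.exp (l * ∑ i ∈ range (n + 1 + 1), Y i ω)) =
      (fun ω => Real.exp (l * ∑ i ∈ range (n + 1), Y i ω)) *
        fun ω => Real.exp (l * Y (n + 1) ω) := by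
    ext ω
    rw [Pi.mul_apply, sum_range_succ, mul_add, Real.exp_add]
  have hexp : Measurable fun y : ℝ => Real.exp (l * y) := by fun_prop
  have hstep : P[fun ω => Real.exp (l * Y (n + 1) ω) | Filtration.natural Y hY n] =ᵐ[P]
      fun _ => mgf (Y (n + 1)) P l :=
    condExp_indep_eq (hY _).measurable.comap_le (Filtration.le _ _)
      (hexp.comp (comap_measurable (Y (n + 1)))).stronglyMeasurable
      (hind.indep_comap_natural_of_lt hY n.lt_succ_self)
  have hone : 1 ≤ mgf (Y (n + 1)) P l := by
    simpa [integral_eq_zero_of_hasSubgaussianMGF (hsub (n + 1))] using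
      one_add_mul_integral_le_mgf (hsub (n + 1)) l
  filter_upwards [hstep, condExp_mul_of_stronglyMeasurable_left (hadapted n)
    (hsplit ▸ hint (n + 1)) ((hsub (n + 1)).integrable_exp_mul l)] with ω hω hmul
  rw [hsplit, hmul, Pi.mul_apply, hω]
  exact le_mul_of_one_le_right (Real.exp_pos _).le hone

lemma measure_exists_exp_mul_sum_ge_le (hY : ∀ i, Measurable (Y i)) (hind : iIndepFun Y P)
    (hsub : ∀ i, HasSubgaussianMGF (Y i) c P) (l : ℝ) {y : ℝ} (hy : 0 < y) (n : ℕ) :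
    P {ω | ∃ m ≤ n, y ≤ Real.exp (l * ∑ i ∈ range (m + 1), Y i ω)} ≤
      ENNReal.ofReal (Real.exp ((n + 1) * c * l ^ 2 / 2) / y) := by
  set M : ℕ → Ω → ℝ := fun n ω => Real.exp (l * ∑ i ∈ range (n + 1), Y i ω)
  have hmax := maximal_ineq (ε := y.toNNReal)
    (submartingale_exp_mul_sum (fun i => (hY i).stronglyMeasurable) hind hsub l)
    (fun m ω => (Real.exp_pos _).le) n
  have hsum : HasSubgaussianMGF (fun ω => ∑ i ∈ range (n + 1), Y i ω) (∑ _i ∈ range (n + 1), c) P :=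
    HasSubgaussianMGF.sum_of_iIndepFun hind fun i _ => hsub i
  have hmgf : ∫ ω, M n ω ∂P ≤ Real.exp ((n + 1) * c * l ^ 2 / 2) := by
    simpa [mgf, M] using hsum.mgf_le l
  have hevent : {ω | ∃ m ≤ n, y ≤ M m ω} = {ω | (y.toNNReal : ℝ) ≤
      (range (n + 1)).sup' nonempty_range_add_one fun k => M k ω} := by
    ext ω
    simp [Real.coe_toNNReal _ hy.le, le_sup'_iff]
  rw [ENNReal.ofReal_div_of_pos hy, ENNReal.le_div_iff_mul_le (by simp [hy]) (by simp), mul_comm,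
    hevent]
  exact hmax.trans (ENNReal.ofReal_le_ofReal ((setIntegral_le_integral (hsum.integrable_exp_mul l)
    (ae_of_all _ fun _ => (Real.exp_pos _).le)).trans hmgf))

lemma measure_exists_sum_ge_le (hY : ∀ i, Measurable (Y i)) (hind : iIndepFun Y P)
    (hsub : ∀ i, HasSubgaussianMGF (Y i) c P) {x : ℝ} (hx : 0 ≤ x) (b : ℕ) :
    P {ω | ∃ m ≤ b, x ≤ ∑ i ∈ range m, Y i ω} ≤
      ENNReal.ofReal (Real.exp (-(x ^ 2 / (2 * b * c)))) := by
  rcases hx.eq_or_lt with rfl | hx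
  · simpa using prob_le_one
  rcases eq_or_ne (2 * b * c : ℝ) 0 with hbc | hbc
  · simpa [hbc] using prob_le_one
  obtain ⟨n, rfl⟩ : ∃ n, b = n + 1 := Nat.exists_eq_succ_of_ne_zero (by rintro rfl; simp at hbc)
  set l : ℝ := x / ((n + 1 : ℕ) * c) with hl
  have hl0 : 0 ≤ l := by positivity
  have hexponent : (n + 1) * c * l ^ 2 / 2 - l * x = -(x ^ 2 / (2 * (n + 1 : ℕ) * c)) := by
    have hn : ((n : ℝ) + 1) ≠ 0 := by positivity
    have hc : (c : ℝ) ≠ 0 := right_ne_zero_of_mul hbc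
    rw [hl]; push_cast; field_simp; ring
  rw [← hexponent, Real.exp_sub]
  refine (measure_mono ?_).trans
    (measure_exists_exp_mul_sum_ge_le hY hind hsub l (Real.exp_pos (l * x)) n)
  rintro ω ⟨m, hm, hxm⟩
  obtain ⟨k, rfl⟩ : ∃ k, m = k + 1 := Nat.exists_eq_succ_of_ne_zero fun h0 => by
    subst h0
    simp only [range_zero, sum_empty] at hxm
    exact hx.not_ge hxm
  exact ⟨k, by omega, Real.exp_le_exp.2 (mul_le_mul_of_nonneg_left hxm hl0)⟩

lemma measure_exists_abs_sum_ge_le (hY : ∀ i, Measurable (Y i)) (hind : iIndepFun Y P)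
    (hsub : ∀ i, HasSubgaussianMGF (Y i) c P) {x : ℝ} (hx : 0 ≤ x) (b : ℕ) :
    P {ω | ∃ m ≤ b, x ≤ |∑ i ∈ range m, Y i ω|} ≤
      2 * ENNReal.ofReal (Real.exp (-(x ^ 2 / (2 * b * c)))) := by
  have hpos := measure_exists_sum_ge_le hY hind hsub hx b
  have hneg := measure_exists_sum_ge_le (fun i => (hY i).neg)
    (hind.comp (fun _ y => -y) fun _ => measurable_neg) (fun i => (hsub i).neg) hx b
  rw [two_mul]
  refine (measure_mono ?_).trans ((measure_union_le _ _).trans (add_le_add hpos hneg))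
  rintro ω ⟨m, hm, h⟩
  refine (le_abs.1 h).imp (fun h => ⟨m, hm, h⟩) fun h => ⟨m, hm, ?_⟩
  simpa using h

end Maximal

section Tails

variable {Ω : Type*} [MeasurableSpace Ω] {P : Measure Ω} [IsProbabilityMeasure P]
  {c : ℝ≥0} {Y : ℕ → Ω → ℝ}

lemma measure_exists_sq_sum_div_ge_le_of_mem_Icc (hY : ∀ i, Measurable (Y i))
    (hind : iIndepFun Y P) (hsub : ∀ i, HasSubgaussianMGF (Y i) c P) {x a b : ℝ} (hx : 0 ≤ x)
    (ha : 0 ≤ a) :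
    P {ω | ∃ n : ℕ, 0 < n ∧ (n : ℝ) ∈ Set.Icc a b ∧ x ≤ (∑ i ∈ range n, Y i ω) ^ 2 / n} ≤
      2 * ENNReal.ofReal (Real.exp (-(x * (a / b) / (2 * c)))) := by
  have hsubset : {ω | ∃ n : ℕ, 0 < n ∧ (n : ℝ) ∈ Set.Icc a b ∧
      x ≤ (∑ i ∈ range n, Y i ω) ^ 2 / n} ⊆
      {ω | ∃ n ≤ ⌊b⌋₊, √(x * a) ≤ |∑ i ∈ range n, Y i ω|} := by
    rintro ω ⟨n, hn, hnab, hxn⟩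
    have hn' : (0 : ℝ) < n := Nat.cast_pos.2 hn
    refine ⟨n, Nat.le_floor hnab.2, Real.sqrt_le_iff.2 ⟨abs_nonneg _, ?_⟩⟩
    rw [sq_abs]
    exact (mul_le_mul_of_nonneg_left hnab.1 hx).trans ((le_div_iff₀ hn').1 hxn)
  rcases lt_or_ge b 1 with hb | hb
  · have hempty : {ω | ∃ n : ℕ, 0 < n ∧ (n : ℝ) ∈ Set.Icc a b ∧
        x ≤ (∑ i ∈ range n, Y i ω) ^ 2 / n} = ∅ := by
      refine Set.eq_empty_of_forall_notMem ?_
      rintro ω ⟨n, hn, hnab, -⟩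
      exact (hnab.2.trans_lt hb).not_ge (Nat.one_le_cast.2 hn)
    rw [hempty, measure_empty]
    exact zero_le
  have hbpos : (0 : ℝ) < ⌊b⌋₊ := Nat.cast_pos.2 (Nat.floor_pos.2 hb)
  refine (measure_mono hsubset).trans
    ((measure_exists_abs_sum_ge_le hY hind hsub (Real.sqrt_nonneg _) _).trans ?_)
  gcongr 2 * ENNReal.ofReal (Real.exp (-?_))
  rw [Real.sq_sqrt (by positivity)]
  calc x * (a / b) / (2 * c) = x * a / (2 * c) / b := by ring
    _ ≤ x * a / (2 * c) / ⌊b⌋₊ := by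
      gcongr
      exact Nat.floor_le (zero_le_one.trans hb)
    _ = x * a / (2 * ⌊b⌋₊ * c) := by rw [div_div, mul_right_comm]

lemma exists_block_of_mem_Ioc {J k n : ℕ} (hJ : 0 < J) (hn : n ∈ Ioc (k / 2) k) :
    ∃ j < J, (n : ℝ) ∈ Set.Icc ((J + j) * (k / (2 * J) : ℝ)) ((J + j + 1) * (k / (2 * J))) := by
  rw [mem_Ioc] at hn
  have hk : (0 : ℝ) < k := by exact_mod_cast (show 0 < k by omega)
  have hkn : (k : ℝ) < 2 * n := by exact_mod_cast (show k < 2 * n by omega)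
  have hnk : (n : ℝ) ≤ k := by exact_mod_cast hn.2
  have hJ' : (0 : ℝ) < J := by exact_mod_cast hJ
  set r : ℝ := J * (2 * n - k) / k with hr
  have hr0 : 0 < r := div_pos (mul_pos hJ' (by linarith)) hk
  have hrJ : r ≤ J := by
    rw [hr, div_le_iff₀ hk]
    exact mul_le_mul_of_nonneg_left (by linarith) hJ'.le
  have hnr : (n : ℝ) = (J + r) * (k / (2 * J)) := by
    rw [hr]; field_simp; ring
  obtain ⟨j, hj⟩ := Nat.exists_eq_succ_of_ne_zero (Nat.ceil_pos.2 hr0).ne'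
  have hjr : (j : ℝ) < r := Nat.lt_ceil.1 (hj ▸ j.lt_succ_self)
  have hrj : r ≤ j + 1 := by exact_mod_cast hj ▸ Nat.le_ceil r
  refine ⟨j, by exact_mod_cast hjr.trans_le hrJ, ?_⟩
  rw [hnr, add_assoc]
  exact ⟨by gcongr, by gcongr⟩

/- Cutting `(k / 2, k]` into `J` blocks of equal length makes the ratio of the endpoints of a block
at least `J / (J + 1)`, so the exponent is as close to the one at a fixed time as desired. -/
lemma measure_exists_sq_sum_div_ge_le (hY : ∀ i, Measurable (Y i)) (hind : iIndepFun Y P)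
    (hsub : ∀ i, HasSubgaussianMGF (Y i) c P) {x : ℝ} (hx : 0 ≤ x) {J : ℕ} (hJ : 0 < J) (k : ℕ) :
    P {ω | ∃ n ∈ Ioc (k / 2) k, x ≤ (∑ i ∈ range n, Y i ω) ^ 2 / n} ≤
      ENNReal.ofReal (2 * J * Real.exp (-(x * (J / (J + 1)) / (2 * c)))) := by
  set w : ℝ := k / (2 * J) with hw
  set B : ℕ → Set Ω := fun j => {ω | ∃ n : ℕ, 0 < n ∧
    (n : ℝ) ∈ Set.Icc ((J + j) * w) ((J + j + 1) * w) ∧ x ≤ (∑ i ∈ range n, Y i ω) ^ 2 / n} with hB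
  have hcover : {ω | ∃ n ∈ Ioc (k / 2) k, x ≤ (∑ i ∈ range n, Y i ω) ^ 2 / n} ⊆
      ⋃ j ∈ range J, B j := by
    rintro ω ⟨n, hn, hxn⟩
    obtain ⟨j, hj, hjn⟩ := exists_block_of_mem_Ioc hJ hn
    have hn0 : 0 < n := by rw [mem_Ioc] at hn; omega
    exact Set.mem_biUnion (mem_range.2 hj) ⟨n, hn0, hjn, hxn⟩
  have hblock : ∀ j ∈ range J,
      P (B j) ≤ 2 * ENNReal.ofReal (Real.exp (-(x * (J / (J + 1)) / (2 * c)))) := fun j _ => by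
    rcases k.eq_zero_or_pos with rfl | hk
    · have hempty : B j = ∅ := by
        refine Set.eq_empty_of_forall_notMem ?_
        rintro ω ⟨n, hn, hnj, -⟩
        have : (n : ℝ) ≤ 0 := by simpa [hw] using hnj.2
        exact hn.not_ge (by exact_mod_cast this)
      simp [hempty]
    have hw0 : 0 < w := by positivity
    refine (measure_exists_sq_sum_div_ge_le_of_mem_Icc hY hind hsub hx (by positivity)).trans ?_
    gcongr 2 * ENNReal.ofReal (Real.exp (-(x * ?_ / _)))
    rw [mul_div_mul_right _ _ hw0.ne', div_le_div_iff₀ (by positivity) (by positivity)]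
    nlinarith [(Nat.cast_nonneg j : (0 : ℝ) ≤ j)]
  calc P _ ≤ ∑ j ∈ range J, P (B j) :=
      (measure_mono hcover).trans (measure_biUnion_finset_le _ _)
    _ ≤ ∑ _j ∈ range J, 2 * ENNReal.ofReal (Real.exp (-(x * (J / (J + 1)) / (2 * c)))) :=
      sum_le_sum hblock
    _ = _ := by
      rw [sum_const, card_range, nsmul_eq_mul, ENNReal.ofReal_mul (by positivity),
        ENNReal.ofReal_mul zero_le_two, ENNReal.ofReal_natCast, ENNReal.ofReal_ofNat]
      ring

end Tails

lemma lintegral_iSup_exp_mul_le {Ω ι : Type*} [MeasurableSpace Ω] [Countable ι] {P : Measure Ω}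
    {s : Set ι} {V : ι → Ω → ℝ} (hV : ∀ n, Measurable (V n)) (hV0 : ∀ n ω, 0 ≤ V n ω) {K a b : ℝ}
    (hK : 0 ≤ K) (ha : 0 ≤ a) (hab : a < b)
    (htail : ∀ j : ℕ, P {ω | ∃ n ∈ s, (j : ℝ) ≤ V n ω} ≤ ENNReal.ofReal (K * Real.exp (-(b * j)))) :
    ∫⁻ ω, ⨆ n ∈ s, ENNReal.ofReal (Real.exp (a * V n ω)) ∂P ≤
      ENNReal.ofReal (K * Real.exp a / (1 - Real.exp (a - b))) := by
  set E : ℕ → Set Ω := fun j => {ω | ∃ n ∈ s, (j : ℝ) ≤ V n ω} with hE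
  have hmeas : ∀ j, MeasurableSet (E j) := fun j => by
    have hunion : E j = ⋃ n ∈ s, {ω | (j : ℝ) ≤ V n ω} := by ext; simp [hE]
    rw [hunion]
    exact .biUnion s.to_countable fun n _ => measurableSet_le measurable_const (hV n)
  have hfloor : ∀ ω, ⨆ n ∈ s, ENNReal.ofReal (Real.exp (a * V n ω)) ≤
      ∑' j : ℕ, (E j).indicator (fun _ => ENNReal.ofReal (Real.exp (a * (j + 1)))) ω := fun ω =>
    iSup₂_le fun n hn => by
      refine le_trans ?_ (ENNReal.le_tsum ⌊V n ω⌋₊)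
      rw [Set.indicator_of_mem (show ω ∈ E _ from ⟨n, hn, Nat.floor_le (hV0 n ω)⟩)]
      gcongr
      exact (Nat.lt_floor_add_one _).le
  have hlt : Real.exp (a - b) < 1 := Real.exp_lt_one_iff.2 (sub_neg.2 hab)
  have hterm : ∀ j : ℕ, Real.exp (a * (j + 1)) * (K * Real.exp (-(b * j))) =
      K * Real.exp a * Real.exp (a - b) ^ j := fun j => by
    rw [← Real.exp_nat_mul, mul_left_comm, ← Real.exp_add, mul_assoc, ← Real.exp_add]
    ring_nf
  calc _ ≤ ∫⁻ ω, ∑' j : ℕ,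
        (E j).indicator (fun _ => ENNReal.ofReal (Real.exp (a * (j + 1)))) ω ∂P :=
        lintegral_mono hfloor
    _ = ∑' j : ℕ, ENNReal.ofReal (Real.exp (a * (j + 1))) * P (E j) := by
        rw [lintegral_tsum fun j => (measurable_const.indicator (hmeas j)).aemeasurable]
        exact tsum_congr fun j => lintegral_indicator_const (hmeas j) _
    _ ≤ ∑' j : ℕ, ENNReal.ofReal (K * Real.exp a * Real.exp (a - b) ^ j) :=
        ENNReal.tsum_le_tsum fun j => by
          rw [← hterm j, ENNReal.ofReal_mul (Real.exp_pos _).le]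
          gcongr
          exact htail j
    _ = ENNReal.ofReal (K * Real.exp a / (1 - Real.exp (a - b))) := by
        rw [← ENNReal.ofReal_tsum_of_nonneg (fun j => by positivity)
          ((summable_geometric_of_lt_one (Real.exp_pos _).le hlt).mul_left _), tsum_mul_left,
          tsum_geometric_of_lt_one (Real.exp_pos _).le hlt, div_eq_mul_inv]

section Sums

lemma exp_neg_div_one_sub_exp_neg_le {a : ℝ} (ha : 0 < a) :
    Real.exp (-a) / (1 - Real.exp (-a)) ≤ 1 / a := by
  have hlt : Real.exp (-a) < 1 := by simpa using ha
  have hmul : (a + 1) * Real.exp (-a) ≤ 1 := by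
    calc (a + 1) * Real.exp (-a) ≤ Real.exp a * Real.exp (-a) := by
          gcongr; exact Real.add_one_le_exp a
      _ = 1 := by rw [← Real.exp_add, add_neg_cancel, Real.exp_zero]
  rw [div_le_div_iff₀ (sub_pos.2 hlt) ha]
  linarith

lemma tsum_exp_neg_succ_mul_le {a : ℝ} (ha : 0 < a) :
    ∑' k : ℕ, ENNReal.ofReal (Real.exp (-((k + 1 : ℕ) * a))) ≤ ENNReal.ofReal (1 / a) := by
  have hlt : Real.exp (-a) < 1 := by simpa using ha
  have hterm : ∀ k : ℕ, Real.exp (-((k + 1 : ℕ) * a)) = Real.exp (-a) * Real.exp (-a) ^ k :=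
    fun k => by
      rw [← pow_succ', ← Real.exp_nat_mul, mul_neg]
  simp_rw [hterm]
  rw [← ENNReal.ofReal_tsum_of_nonneg (fun k => by positivity)
    ((summable_geometric_of_lt_one (Real.exp_pos _).le hlt).mul_left _), tsum_mul_left,
    tsum_geometric_of_lt_one (Real.exp_pos _).le hlt, ← div_eq_mul_inv]
  exact ENNReal.ofReal_le_ofReal (exp_neg_div_one_sub_exp_neg_le ha)

lemma sum_Icc_exp_neg_mul_le {a : ℝ} (ha : 0 < a) (T : ℕ) :
    ∑ k ∈ Icc 1 T, ENNReal.ofReal (Real.exp (-(k * a))) ≤ ENNReal.ofReal (1 / a) := by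
  refine le_trans ?_ (tsum_exp_neg_succ_mul_le ha)
  rw [← Ico_add_one_right_eq_Icc, sum_Ico_eq_sum_range]
  simp_rw [add_comm 1, Nat.add_sub_cancel]
  exact ENNReal.sum_le_tsum _

/- Cauchy condensation, which costs the factor `3`, reduces the sum to a geometric one. -/
lemma tsum_two_pow_mul_exp_neg_le {a : ℝ} (ha : 0 < a) :
    ∑' j : ℕ, 2 ^ j * ENNReal.ofReal (Real.exp (-((2 ^ j : ℕ) * a))) ≤
      3 * ENNReal.ofReal (1 / a) := by
  set f : ℕ → ℝ≥0∞ := fun k => if k = 0 then 0 else ENNReal.ofReal (Real.exp (-(k * a))) with hf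
  have hanti : ∀ ⦃m n : ℕ⦄, 1 < m → m ≤ n → f n ≤ f m := fun m n hm hmn => by
    have hm0 : 0 < m := zero_lt_one.trans hm
    simp only [hf, hm0.ne', (hm0.trans_le hmn).ne', if_false]
    gcongr
  have hsum : ∑' k, f k ≤ ENNReal.ofReal (1 / a) := by
    rw [tsum_eq_zero_add' ENNReal.summable]
    simpa [hf] using tsum_exp_neg_succ_mul_le ha
  calc _ = ∑' j : ℕ, 2 ^ j * f (2 ^ j) := by simp [hf]
    _ ≤ f 1 + 2 * ∑' k, f k := ENNReal.tsum_condensed_le hanti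
    _ ≤ ∑' k, f k + 2 * ∑' k, f k := by gcongr; exact ENNReal.le_tsum 1
    _ = 3 * ∑' k, f k := by ring
    _ ≤ _ := by gcongr

lemma card_filter_Icc_cast_le {K : ℝ} (hK : 0 ≤ K) (T : ℕ) :
    (#{k ∈ Icc 1 T | ((k : ℕ) : ℝ) ≤ K} : ℝ≥0∞) ≤ ENNReal.ofReal K := by
  calc (#{k ∈ Icc 1 T | ((k : ℕ) : ℝ) ≤ K} : ℝ≥0∞) ≤ #(Icc 1 ⌊K⌋₊) := by
        refine Nat.cast_le.2 (card_le_card fun k hk => ?_)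
        simp only [mem_filter, mem_Icc] at hk ⊢
        exact ⟨hk.1.1, Nat.le_floor hk.2⟩
    _ = ENNReal.ofReal ⌊K⌋₊ := by simp
    _ ≤ ENNReal.ofReal K := ENNReal.ofReal_le_ofReal (Nat.floor_le hK)

end Sums

section Clip

lemma exp_neg_posLog_le {u : ℝ} (hu : 0 < u) : Real.exp (-Real.posLog u) ≤ 1 / u := by
  rw [one_div, ← Real.exp_log (inv_pos.2 hu), Real.exp_le_exp, Real.log_inv, neg_le_neg_iff]
  exact le_max_right _ _

variable {N T : ℕ} {α δ : ℝ}

lemma empMean_sub_const {x : ℕ → ℝ} (μ : ℝ) {n : ℕ} (hn : n ≠ 0) :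
    empMean (fun i => x i - μ) n = empMean x n - μ := by
  have hn' : (n : ℝ) ≠ 0 := Nat.cast_ne_zero.2 hn
  simp only [empMean, sum_sub_distrib, sum_const, card_range, nsmul_eq_mul, sub_div,
    mul_div_cancel_left₀ _ hn']

lemma clipLevel_sub_const {x : ℕ → ℝ} (μ : ℝ) {n : ℕ} (hn : n ≠ 0) :
    clipLevel N T α (fun i => x i - μ) n = clipLevel N T α x n - μ := by
  rw [clipLevel, clipLevel, empMean_sub_const μ hn]
  ring

lemma natCast_mul_clipLevel {x : ℕ → ℝ} {n : ℕ} (hn : n ≠ 0) :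
    n * clipLevel N T α x n =
      ∑ i ∈ range n, x i + √(α * n * Real.posLog ((T : ℝ) / (n * N))) := by
  have hn' : (n : ℝ) ≠ 0 := Nat.cast_ne_zero.2 hn
  have hroot : α * n * Real.posLog ((T : ℝ) / (n * N)) =
      n ^ 2 * (α / n * Real.posLog ((T : ℝ) / (n * N))) := by
    field_simp
  rw [hroot, Real.sqrt_mul (sq_nonneg _), Real.sqrt_sq n.cast_nonneg, clipLevel, mul_add, empMean,
    mul_div_cancel₀ _ hn']

/-- The value that the negated sum of `n` rewards, where `2 ^ j ≤ n < 2 ^ (j + 1)`, has to reach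
for the clipping level to be at most `-δ`. -/
noncomputable def dyadicThreshold (N T : ℕ) (α δ : ℝ) (j : ℕ) : ℝ :=
  2 ^ j * δ + √(α * 2 ^ j * Real.posLog ((T : ℝ) / (2 ^ (j + 1) * N)))

lemma dyadicThreshold_le_of_clipLevel_le (hN : 0 < N) (hα : 0 ≤ α) (hδ : 0 ≤ δ) {x : ℕ → ℝ}
    {n : ℕ} (hn : n ≠ 0) (h : clipLevel N T α x n ≤ -δ) :
    dyadicThreshold N T α δ (Nat.log 2 n) ≤ ∑ i ∈ range n, -x i := by
  set j := Nat.log 2 n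
  have hlow : (2 : ℝ) ^ j ≤ n := by exact_mod_cast Nat.pow_log_le_self 2 hn
  have hup : (n : ℝ) ≤ 2 ^ (j + 1) := by
    exact_mod_cast (Nat.lt_pow_succ_log_self one_lt_two n).le
  have : (0 : ℝ) < n := Nat.cast_pos.2 (Nat.pos_of_ne_zero hn)
  have hlog : Real.posLog ((T : ℝ) / (2 ^ (j + 1) * N)) ≤ Real.posLog ((T : ℝ) / (n * N)) :=
    Real.posLog_le_posLog (by positivity) (by gcongr)
  have hroot : √(α * 2 ^ j * Real.posLog ((T : ℝ) / (2 ^ (j + 1) * N))) ≤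
      √(α * n * Real.posLog ((T : ℝ) / (n * N))) := by
    have hlog0 : 0 ≤ Real.posLog ((T : ℝ) / (2 ^ (j + 1) * N)) := Real.posLog_nonneg
    gcongr
  have hmul : ∑ i ∈ range n, x i + √(α * n * Real.posLog ((T : ℝ) / (n * N))) ≤ n * -δ := by
    rw [← natCast_mul_clipLevel hn]
    gcongr
  have hlin : (2 : ℝ) ^ j * δ ≤ n * δ := by gcongr
  rw [sum_neg_distrib, dyadicThreshold]
  linarith

lemma add_le_sq_add_sqrt_div (hα : 4 ≤ α) (hδ : 0 ≤ δ) {w L : ℝ} (hw : 0 < w) (hL : 0 ≤ L) :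
    w * (δ ^ 2 / 4) + L ≤ (w * δ + √(α * w * L)) ^ 2 / (4 * w) := by
  have hsq : √(α * w * L) ^ 2 = α * w * L := Real.sq_sqrt (by positivity)
  have hcross : 0 ≤ w * δ * √(α * w * L) := by positivity
  have hα' : 4 * w * L ≤ α * w * L := by gcongr
  rw [le_div_iff₀ (by positivity)]
  linarith

lemma exp_neg_sq_dyadicThreshold_le (hN : 0 < N) (hT : 0 < T) (hα : 4 ≤ α) (hδ : 0 ≤ δ) (j : ℕ) :
    Real.exp (-(dyadicThreshold N T α δ j ^ 2 / (4 * 2 ^ j))) ≤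
      2 * N / T * (2 ^ j * Real.exp (-(2 ^ j * (δ ^ 2 / 4)))) := by
  set L := Real.posLog ((T : ℝ) / (2 ^ (j + 1) * N))
  have : (0 : ℝ) < N := Nat.cast_pos.2 hN
  have : (0 : ℝ) < T := Nat.cast_pos.2 hT
  have hexp : Real.exp (-L) ≤ 2 ^ (j + 1) * N / T := by
    simpa only [one_div_div] using
      exp_neg_posLog_le (u := (T : ℝ) / (2 ^ (j + 1) * N)) (by positivity)
  calc Real.exp (-(dyadicThreshold N T α δ j ^ 2 / (4 * 2 ^ j)))
      ≤ Real.exp (-(2 ^ j * (δ ^ 2 / 4) + L)) := by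
        gcongr
        exact add_le_sq_add_sqrt_div hα hδ (by positivity) Real.posLog_nonneg
    _ = Real.exp (-(2 ^ j * (δ ^ 2 / 4))) * Real.exp (-L) := by rw [← Real.exp_add, neg_add]
    _ ≤ Real.exp (-(2 ^ j * (δ ^ 2 / 4))) * (2 ^ (j + 1) * N / T) := by gcongr
    _ = 2 * N / T * (2 ^ j * Real.exp (-(2 ^ j * (δ ^ 2 / 4)))) := by ring

lemma sqrt_clip_le_half (hN : 0 < N) (hα : 0 ≤ α) (hδ : 0 ≤ δ) {n : ℕ}
    (hn : 4 * α * Real.posLog (T * δ ^ 2 / N) + 1 ≤ n * δ ^ 2) :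
    √(α / n * Real.posLog ((T : ℝ) / (n * N))) ≤ δ / 2 := by
  set L := Real.posLog (T * δ ^ 2 / N)
  have hL : 0 ≤ 4 * α * L := mul_nonneg (by positivity) Real.posLog_nonneg
  have hN' : (0 : ℝ) < N := Nat.cast_pos.2 hN
  have hn' : (0 : ℝ) < n := by
    by_contra! h
    nlinarith [mul_nonneg (neg_nonneg.2 h) (sq_nonneg δ)]
  have hlog : Real.posLog ((T : ℝ) / (n * N)) ≤ L := by
    refine Real.posLog_le_posLog (by positivity) ?_
    rw [div_le_div_iff₀ (by positivity) hN']
    calc (T : ℝ) * N = T * N * 1 := by ring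
      _ ≤ T * N * (n * δ ^ 2) := by gcongr; linarith
      _ = _ := by ring
  rw [Real.sqrt_le_left (by positivity)]
  calc α / n * Real.posLog ((T : ℝ) / (n * N)) ≤ α / n * L := by gcongr
    _ ≤ (δ / 2) ^ 2 := by
      rw [div_mul_eq_mul_div, div_le_iff₀ hn']
      linarith

variable {Ω : Type*} [MeasurableSpace Ω] {P : Measure Ω} [IsProbabilityMeasure P] {Y : ℕ → Ω → ℝ}

lemma measure_exists_clipLevel_le (hY : ∀ i, Measurable (Y i)) (hind : iIndepFun Y P)
    (hsub : ∀ i, HasSubgaussianMGF (Y i) 1 P) (hα : 4 ≤ α) (hN : 0 < N) (hT : 0 < T) (hδ : 0 < δ) :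
    P {ω | ∃ n ∈ Icc 1 T, clipLevel N T α (fun i => Y i ω) n ≤ -δ} ≤
      ENNReal.ofReal (24 * N / (T * δ ^ 2)) := by
  set B : ℕ → Set Ω := fun j =>
    {ω | ∃ n ≤ 2 ^ (j + 1), dyadicThreshold N T α δ j ≤ ∑ i ∈ range n, (-Y i) ω}
  have hcover : {ω | ∃ n ∈ Icc 1 T, clipLevel N T α (fun i => Y i ω) n ≤ -δ} ⊆ ⋃ j, B j := by
    rintro ω ⟨n, hn, h⟩
    have hn0 : n ≠ 0 := Nat.one_le_iff_ne_zero.1 (mem_Icc.1 hn).1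
    exact Set.mem_iUnion.2 ⟨Nat.log 2 n, n, (Nat.lt_pow_succ_log_self one_lt_two n).le,
      dyadicThreshold_le_of_clipLevel_le hN (by linarith) hδ.le hn0 h⟩
  have hscale : ∀ j, P (B j) ≤ ENNReal.ofReal (2 * N / T) *
      (2 ^ j * ENNReal.ofReal (Real.exp (-((2 ^ j : ℕ) * (δ ^ 2 / 4))))) := fun j => by
    have hmax := measure_exists_sum_ge_le (fun i => (hY i).neg)
      (hind.comp (fun _ y => -y) fun _ => measurable_neg) (fun i => (hsub i).neg)
      (by rw [dyadicThreshold]; positivity : 0 ≤ dyadicThreshold N T α δ j) (2 ^ (j + 1))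
    have hpow : (2 : ℝ≥0∞) ^ j = ENNReal.ofReal (2 ^ j) := by
      rw [ENNReal.ofReal_pow zero_le_two, ENNReal.ofReal_ofNat]
    rw [hpow, ← ENNReal.ofReal_mul (by positivity), ← ENNReal.ofReal_mul (by positivity)]
    refine hmax.trans (ENNReal.ofReal_le_ofReal ?_)
    have hden : (2 * (2 ^ (j + 1) : ℕ) * (1 : ℝ≥0) : ℝ) = 4 * 2 ^ j := by push_cast; ring
    rw [hden]
    exact_mod_cast exp_neg_sq_dyadicThreshold_le hN hT hα hδ.le j
  calc P _ ≤ ∑' j, P (B j) := (measure_mono hcover).trans (measure_iUnion_le _)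
    _ ≤ ENNReal.ofReal (2 * N / T) *
        ∑' j : ℕ, 2 ^ j * ENNReal.ofReal (Real.exp (-((2 ^ j : ℕ) * (δ ^ 2 / 4)))) :=
      (ENNReal.tsum_le_tsum hscale).trans ENNReal.tsum_mul_left.le
    _ ≤ ENNReal.ofReal (2 * N / T) * (3 * ENNReal.ofReal (1 / (δ ^ 2 / 4))) := by
      gcongr
      exact tsum_two_pow_mul_exp_neg_le (by positivity)
    _ = ENNReal.ofReal (24 * N / (T * δ ^ 2)) := by
      rw [← ENNReal.ofReal_ofNat 3, ← ENNReal.ofReal_mul (by positivity),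
        ← ENNReal.ofReal_mul (by positivity)]
      congr 1
      field_simp
      norm_num

lemma measure_exists_lt_clipLevel_le (hY : ∀ i, Measurable (Y i)) (hind : iIndepFun Y P)
    (hsub : ∀ i, HasSubgaussianMGF (Y i) 1 P) (hα : 0 ≤ α) (hN : 0 < N) (hδ : 0 < δ) {k : ℕ}
    (hk : 2 * (4 * α * Real.posLog (T * δ ^ 2 / N) + 1) / δ ^ 2 < k) :
    P {ω | ∃ n ∈ Ioc (k / 2) k, δ < clipLevel N T α (fun i => Y i ω) n} ≤
      ENNReal.ofReal (Real.exp (-(k * (δ ^ 2 / 32)))) := by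
  have hmax := measure_exists_sum_ge_le hY hind hsub (x := k * δ / 4) (by positivity) k
  have hk0 : (0 : ℝ) < k :=
    lt_of_le_of_lt (by have : 0 ≤ Real.posLog (T * δ ^ 2 / N) := Real.posLog_nonneg; positivity) hk
  have hexponent : (k * δ / 4) ^ 2 / (2 * k * (1 : ℝ≥0)) = k * (δ ^ 2 / 32) := by
    push_cast; field_simp; norm_num
  rw [hexponent] at hmax
  refine (measure_mono ?_).trans hmax
  rintro ω ⟨n, hn, hlt⟩
  rw [mem_Ioc] at hn
  have hn' : (0 : ℝ) < n := by exact_mod_cast (show 0 < n by omega)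
  have hkn : (k : ℝ) < 2 * n := by exact_mod_cast (show k < 2 * n by omega)
  have hlarge : 4 * α * Real.posLog (T * δ ^ 2 / N) + 1 ≤ n * δ ^ 2 := by
    have := (div_lt_iff₀ (by positivity)).1 (hk.trans hkn)
    linarith
  have hmean : δ / 2 ≤ (∑ i ∈ range n, Y i ω) / n := by
    have := sqrt_clip_le_half hN hα hδ.le hlarge
    rw [clipLevel, empMean] at hlt
    linarith
  rw [le_div_iff₀ hn'] at hmean
  refine ⟨n, hn.2, le_trans ?_ hmean⟩
  calc k * δ / 4 ≤ 2 * n * δ / 4 := by gcongr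
    _ = δ / 2 * n := by ring

lemma sum_measure_exists_lt_clipLevel_le (hY : ∀ i, Measurable (Y i)) (hind : iIndepFun Y P)
    (hsub : ∀ i, HasSubgaussianMGF (Y i) 1 P) (hα : 0 ≤ α) (hN : 0 < N) (hδ : 0 < δ) :
    ∑ k ∈ Icc 1 T, P {ω | ∃ n ∈ Ioc (k / 2) k, δ < clipLevel N T α (fun i => Y i ω) n} ≤
      ENNReal.ofReal ((8 * α * Real.posLog (T * δ ^ 2 / N) + 34) / δ ^ 2) := by
  set K := 2 * (4 * α * Real.posLog (T * δ ^ 2 / N) + 1) / δ ^ 2 with hK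
  have hK0 : 0 ≤ K := by
    have : 0 ≤ Real.posLog (T * δ ^ 2 / N) := Real.posLog_nonneg
    positivity
  have hterm : ∀ k ∈ Icc 1 T,
      P {ω | ∃ n ∈ Ioc (k / 2) k, δ < clipLevel N T α (fun i => Y i ω) n} ≤
      (if (k : ℝ) ≤ K then 1 else 0) + ENNReal.ofReal (Real.exp (-(k * (δ ^ 2 / 32)))) := by
    intro k _
    split_ifs with hkK
    · exact prob_le_one.trans le_self_add
    · rw [zero_add]
      exact measure_exists_lt_clipLevel_le hY hind hsub hα hN hδ (not_le.1 hkK)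
  calc _ ≤ (#{k ∈ Icc 1 T | ((k : ℕ) : ℝ) ≤ K} : ℝ≥0∞) +
        ∑ k ∈ Icc 1 T, ENNReal.ofReal (Real.exp (-(k * (δ ^ 2 / 32)))) := by
        rw [← sum_boole, ← sum_add_distrib]
        exact sum_le_sum hterm
    _ ≤ ENNReal.ofReal K + ENNReal.ofReal (1 / (δ ^ 2 / 32)) :=
        add_le_add (card_filter_Icc_cast_le hK0 T) (sum_Icc_exp_neg_mul_le (by positivity) T)
    _ = _ := by
        rw [← ENNReal.ofReal_add hK0 (by positivity), hK]
        congr 1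
        field_simp
        ring

end Clip

section Gaussian

/-- Odds that a standard normal number is at most `w`. -/
noncomputable def gaussOdds (w : ℝ) : ℝ≥0∞ :=
  gaussianReal 0 1 (Set.Iic w) / gaussianReal 0 1 (Set.Ioi w)

lemma monotone_gaussOdds : Monotone gaussOdds := fun _ _ h =>
  ENNReal.div_le_div (measure_mono (Set.Iic_subset_Iic.2 h)) (measure_mono (Set.Ioi_subset_Ioi h))

lemma exp_neg_sq_le_gaussianReal_Ioi {w : ℝ} (hw : 0 ≤ w) :
    ENNReal.ofReal ((√(2 * Real.pi))⁻¹ * Real.exp (-((w + 1) ^ 2 / 2))) ≤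
      gaussianReal 0 1 (Set.Ioi w) := by
  calc ENNReal.ofReal ((√(2 * Real.pi))⁻¹ * Real.exp (-((w + 1) ^ 2 / 2)))
      = ∫⁻ _ in Set.Ioc w (w + 1),
          ENNReal.ofReal ((√(2 * Real.pi))⁻¹ * Real.exp (-((w + 1) ^ 2 / 2))) := by simp
    _ ≤ ∫⁻ y in Set.Ioc w (w + 1), gaussianPDF 0 1 y := by
        refine setLIntegral_mono' measurableSet_Ioc fun y hy => ENNReal.ofReal_le_ofReal ?_
        simp only [gaussianPDFReal, NNReal.coe_one, mul_one, sub_zero, neg_div]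
        have hy0 : 0 ≤ y := hw.trans hy.1.le
        gcongr
        exact hy.2
    _ = gaussianReal 0 1 (Set.Ioc w (w + 1)) := (gaussianReal_apply 0 one_ne_zero _).symm
    _ ≤ _ := measure_mono Set.Ioc_subset_Ioi_self

lemma gaussianReal_Ioi_ne_zero (w : ℝ) : gaussianReal 0 1 (Set.Ioi w) ≠ 0 := by
  have hmax := (exp_neg_sq_le_gaussianReal_Ioi (le_max_right w 0)).trans
    (measure_mono (Set.Ioi_subset_Ioi (le_max_left w 0)))
  exact ((ENNReal.ofReal_pos.2 (by positivity)).trans_le hmax).ne'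

lemma gaussianReal_Iic_le_exp_neg_sq {w : ℝ} (hw : w ≤ 0) :
    gaussianReal 0 1 (Set.Iic w) ≤ ENNReal.ofReal (Real.exp (-(w ^ 2 / 2))) := by
  have hsub : HasSubgaussianMGF (fun y : ℝ => y) 1 (gaussianReal 0 1) :=
    ⟨fun t => integrable_exp_mul_gaussianReal t, fun t => by rw [mgf_fun_id_gaussianReal]; simp⟩
  have htail := hsub.neg.measure_ge_le (neg_nonneg.2 hw)
  have hset : {y : ℝ | -w ≤ (-fun y : ℝ => y) y} = Set.Iic w := by ext; simp
  rw [hset] at htail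
  rw [← ofReal_measureReal]
  refine ENNReal.ofReal_le_ofReal (htail.trans_eq ?_)
  simp [neg_div]

lemma gaussOdds_le_of_nonneg {w : ℝ} (hw : 0 ≤ w) :
    gaussOdds w ≤ ENNReal.ofReal (√(2 * Real.pi) * Real.exp ((w + 1) ^ 2 / 2)) := by
  have hpos : 0 < (√(2 * Real.pi))⁻¹ * Real.exp (-((w + 1) ^ 2 / 2)) := by positivity
  calc gaussOdds w ≤ 1 / ENNReal.ofReal ((√(2 * Real.pi))⁻¹ * Real.exp (-((w + 1) ^ 2 / 2))) :=
        ENNReal.div_le_div prob_le_one (exp_neg_sq_le_gaussianReal_Ioi hw)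
    _ = _ := by
      rw [one_div, ← ENNReal.ofReal_inv_of_pos hpos, mul_inv, inv_inv, Real.exp_neg, inv_inv]

lemma gaussOdds_le_of_nonpos {w : ℝ} (hw : w ≤ 0) :
    gaussOdds w ≤ ENNReal.ofReal (√(2 * Real.pi) * Real.exp (1 / 2) * Real.exp (-(w ^ 2 / 2))) := by
  have hden := (exp_neg_sq_le_gaussianReal_Ioi le_rfl).trans
    (measure_mono (Set.Ioi_subset_Ioi hw))
  have hpos : 0 < (√(2 * Real.pi))⁻¹ * Real.exp (-(((0 : ℝ) + 1) ^ 2 / 2)) := by positivity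
  calc gaussOdds w ≤ ENNReal.ofReal (Real.exp (-(w ^ 2 / 2))) /
      ENNReal.ofReal ((√(2 * Real.pi))⁻¹ * Real.exp (-(((0 : ℝ) + 1) ^ 2 / 2))) :=
        ENNReal.div_le_div (gaussianReal_Iic_le_exp_neg_sq hw) hden
    _ = _ := by
      rw [← ENNReal.ofReal_div_of_pos hpos, Real.exp_neg (((0 : ℝ) + 1) ^ 2 / 2), zero_add, one_pow]
      congr 1
      field_simp

lemma add_one_sq_le {η : ℝ} (hη : 0 < η) (v : ℝ) : (v + 1) ^ 2 ≤ (1 + η) * v ^ 2 + (1 + 1 / η) := by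
  have hsq : 0 ≤ (η * v - 1) ^ 2 / η := by positivity
  have hexpand : (η * v - 1) ^ 2 / η = η * v ^ 2 - 2 * v + 1 / η := by
    field_simp; ring
  linarith

variable {ρ ε d : ℝ}

lemma gaussOdds_sample_le_of_neg_half_le (hρ : 0 ≤ ρ) (hε : 0 ≤ ε) (hd : -(ε / 2) ≤ d) (n : ℕ) :
    gaussOdds (√(ρ * n) * (-ε - d)) ≤
      ENNReal.ofReal (√(2 * Real.pi) * Real.exp (1 / 2) * Real.exp (-(ρ / 8 * (n * ε ^ 2)))) := by
  have hw : √(ρ * n) * (-ε - d) ≤ √(ρ * n) * -(ε / 2) := by gcongr; linarith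
  have hsq : (√(ρ * n) * -(ε / 2)) ^ 2 / 2 = ρ / 8 * (n * ε ^ 2) := by
    rw [mul_pow, Real.sq_sqrt (by positivity)]; ring
  rw [← hsq]
  exact (monotone_gaussOdds hw).trans (gaussOdds_le_of_nonpos
    (mul_nonpos_of_nonneg_of_nonpos (Real.sqrt_nonneg _) (by linarith)))

lemma gaussOdds_sample_le_of_nonpos (hρ : 0 < ρ) (hρ' : ρ < 1) (hε : 0 ≤ ε) (hd : d ≤ 0) (n : ℕ) :
    gaussOdds (√(ρ * n) * (-ε - d)) ≤ ENNReal.ofReal (√(2 * Real.pi) *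
      Real.exp ((1 + 3 * ρ / (1 - ρ)) / 2) * Real.exp ((1 + 2 * ρ) / 6 * (n * d ^ 2))) := by
  have : 0 < 1 - ρ := sub_pos.2 hρ'
  set v := √(ρ * n) * -d with hv
  have hv0 : 0 ≤ v := mul_nonneg (Real.sqrt_nonneg _) (neg_nonneg.2 hd)
  have hw : √(ρ * n) * (-ε - d) ≤ v :=
    mul_le_mul_of_nonneg_left (by linarith) (Real.sqrt_nonneg _)
  have hv2 : v ^ 2 = ρ * (n * d ^ 2) := by
    rw [hv, mul_pow, Real.sq_sqrt (by positivity)]; ring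
  have hyoung := add_one_sq_le (η := (1 - ρ) / (3 * ρ)) (by positivity) v
  have hcoef : (1 + (1 - ρ) / (3 * ρ)) * v ^ 2 = (1 + 2 * ρ) / 3 * (n * d ^ 2) := by
    rw [hv2]; field_simp; ring
  rw [hcoef, one_div_div] at hyoung
  refine (monotone_gaussOdds hw).trans ((gaussOdds_le_of_nonneg hv0).trans ?_)
  rw [mul_assoc, ← Real.exp_add]
  gcongr
  linarith

/-- The constant in front of the exponentials in the bound for the odds that a sample is small. -/
noncomputable def oddsConst (ρ : ℝ) : ℝ := √(2 * Real.pi) * Real.exp ((1 + 3 * ρ / (1 - ρ)) / 2)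

/- `n * d ^ 2` has an exponential moment of every order below `1 / 2`. As `ρ < 1`, the order
`(2 + ρ) / 6` is admissible and leaves room for a factor that decays in `n`. -/
lemma gaussOdds_sample_le (hρ : 0 < ρ) (hρ' : ρ < 1) (hε : 0 ≤ ε) (d : ℝ) (n : ℕ) :
    gaussOdds (√(ρ * n) * (-ε - d)) ≤
      ENNReal.ofReal (oddsConst ρ * Real.exp (-(ρ * (1 - ρ) / 24 * (n * ε ^ 2)))) *
      ENNReal.ofReal (Real.exp ((2 + ρ) / 6 * (n * d ^ 2))) := by
  have : 0 < 1 - ρ := sub_pos.2 hρ'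
  have hnε : 0 ≤ n * ε ^ 2 := by positivity
  have : 0 ≤ n * d ^ 2 := by positivity
  rw [oddsConst, ← ENNReal.ofReal_mul (by positivity), mul_assoc _ (Real.exp (-_)), ← Real.exp_add]
  rcases le_or_gt (-(ε / 2)) d with h | h
  · refine (gaussOdds_sample_le_of_neg_half_le hρ.le hε h n).trans (ENNReal.ofReal_le_ofReal ?_)
    have hrate : ρ * (1 - ρ) / 24 * (n * ε ^ 2) ≤ ρ / 8 * (n * ε ^ 2) :=
      mul_le_mul_of_nonneg_right (by nlinarith) hnε
    gcongr
    · exact le_add_of_nonneg_right (by positivity)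
    · have : 0 ≤ (2 + ρ) / 6 * (n * d ^ 2) := by positivity
      linarith
  · refine (gaussOdds_sample_le_of_nonpos hρ hρ' hε (by linarith) n).trans
      (ENNReal.ofReal_le_ofReal ?_)
    have hεd : n * ε ^ 2 ≤ 4 * (n * d ^ 2) := by
      have : ε ^ 2 ≤ 4 * d ^ 2 := by nlinarith
      nlinarith [(Nat.cast_nonneg n : (0 : ℝ) ≤ n)]
    have hrate : ρ * (1 - ρ) / 24 * (n * ε ^ 2) ≤ 1 * (1 - ρ) / 24 * (4 * (n * d ^ 2)) := by gcongr
    gcongr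
    linarith

end Gaussian

section SampleLoss

/-- The number of blocks into which `(k / 2, k]` is cut so that the maximal inequality yields an
exponent larger than `(2 + ρ) / 6`. -/
noncomputable def numBlocks (ρ : ℝ) : ℕ := ⌈3 / (1 - ρ)⌉₊

/-- Bound for the expectation of the largest `exp ((2 + ρ) / 6 * Sₙ² / n)` with `k / 2 < n ≤ k`. -/
noncomputable def expSupConst (ρ : ℝ) : ℝ :=
  2 * numBlocks ρ * Real.exp ((2 + ρ) / 6) /
    (1 - Real.exp ((2 + ρ) / 6 - numBlocks ρ / (numBlocks ρ + 1) / 2))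

/-- The constant in the bound for the number of rounds lost because the samples of an arm are too
small. -/
noncomputable def sampleLossConst (ρ : ℝ) : ℝ := 48 * oddsConst ρ * expSupConst ρ / (ρ * (1 - ρ))

variable {ρ : ℝ}

lemma numBlocks_pos (hρ : ρ < 1) : 0 < numBlocks ρ :=
  Nat.ceil_pos.2 (div_pos three_pos (sub_pos.2 hρ))

lemma lt_numBlocks_div (hρ : ρ < 1) :
    (2 + ρ) / 6 < numBlocks ρ / (numBlocks ρ + 1) / 2 := by
  have hJ : 3 / (1 - ρ) ≤ numBlocks ρ := Nat.le_ceil _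
  rw [div_le_iff₀ (sub_pos.2 hρ)] at hJ
  rw [div_div, div_lt_div_iff₀ (by norm_num) (by positivity)]
  linarith

lemma expSupConst_nonneg (hρ : ρ < 1) : 0 ≤ expSupConst ρ :=
  div_nonneg (by positivity)
    (sub_nonneg.2 (Real.exp_le_one_iff.2 (sub_nonpos.2 (lt_numBlocks_div hρ).le)))

lemma sampleLossConst_nonneg (hρ : 0 < ρ) (hρ' : ρ < 1) : 0 ≤ sampleLossConst ρ := by
  have := expSupConst_nonneg hρ'
  have : 0 < 1 - ρ := sub_pos.2 hρ'
  unfold sampleLossConst oddsConst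
  positivity

variable {Ω : Type*} [MeasurableSpace Ω] {P : Measure Ω} [IsProbabilityMeasure P] {Y : ℕ → Ω → ℝ}

lemma lintegral_iSup_exp_sq_sum_div_le (hρ : 0 < ρ) (hρ' : ρ < 1) (hY : ∀ i, Measurable (Y i))
    (hind : iIndepFun Y P) (hsub : ∀ i, HasSubgaussianMGF (Y i) 1 P) (k : ℕ) :
    ∫⁻ ω, ⨆ n ∈ Ioc (k / 2) k,
        ENNReal.ofReal (Real.exp ((2 + ρ) / 6 * ((∑ i ∈ range n, Y i ω) ^ 2 / n))) ∂P ≤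
      ENNReal.ofReal (expSupConst ρ) := by
  refine lintegral_iSup_exp_mul_le (s := {n | n ∈ Ioc (k / 2) k})
    (V := fun n ω => (∑ i ∈ range n, Y i ω) ^ 2 / n) (fun n => by fun_prop)
    (fun n ω => by positivity) (by positivity) (by positivity) (lt_numBlocks_div hρ') fun j => ?_
  refine (measure_exists_sq_sum_div_ge_le hY hind hsub j.cast_nonneg (numBlocks_pos hρ')
    k).trans_eq ?_
  push_cast
  congr 4
  ring

lemma lintegral_iSup_gaussOdds_le (hρ : 0 < ρ) (hρ' : ρ < 1) (hY : ∀ i, Measurable (Y i))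
    (hind : iIndepFun Y P) (hsub : ∀ i, HasSubgaussianMGF (Y i) 1 P) {ε : ℝ} (hε : 0 ≤ ε) (k : ℕ) :
    ∫⁻ ω, ⨆ n ∈ Ioc (k / 2) k, gaussOdds (√(ρ * n) * (-ε - (∑ i ∈ range n, Y i ω) / n)) ∂P ≤
      ENNReal.ofReal (oddsConst ρ * expSupConst ρ) *
        ENNReal.ofReal (Real.exp (-(k * (ρ * (1 - ρ) / 48 * ε ^ 2)))) := by
  have : 0 < 1 - ρ := sub_pos.2 hρ'
  have hA : 0 ≤ oddsConst ρ := by unfold oddsConst; positivity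
  set r : ℝ := ρ * (1 - ρ) / 48 * ε ^ 2 with hr
  have hpointwise : ∀ ω, ⨆ n ∈ Ioc (k / 2) k,
      gaussOdds (√(ρ * n) * (-ε - (∑ i ∈ range n, Y i ω) / n)) ≤
      ENNReal.ofReal (oddsConst ρ * Real.exp (-(k * r))) * ⨆ n ∈ Ioc (k / 2) k,
        ENNReal.ofReal (Real.exp ((2 + ρ) / 6 * ((∑ i ∈ range n, Y i ω) ^ 2 / n))) := fun ω => by
    refine iSup₂_le fun n hn => (gaussOdds_sample_le hρ hρ' hε _ n).trans (mul_le_mul' ?_ ?_)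
    · have hkn : (k : ℝ) ≤ 2 * n := by
        rw [mem_Ioc] at hn
        exact_mod_cast (show k ≤ 2 * n by omega)
      refine ENNReal.ofReal_le_ofReal ?_
      gcongr oddsConst ρ * Real.exp (-?_)
      calc k * r ≤ 2 * n * r := by gcongr
        _ = ρ * (1 - ρ) / 24 * (n * ε ^ 2) := by rw [hr]; ring
    · have hn0 : (n : ℝ) ≠ 0 := by
        rw [mem_Ioc] at hn
        exact_mod_cast (show n ≠ 0 by omega)
      refine le_iSup₂_of_le n hn (le_of_eq ?_)
      congr 3
      field_simp
  refine (lintegral_mono hpointwise).trans ?_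
  rw [lintegral_const_mul' _ _ ENNReal.ofReal_ne_top, mul_comm (oddsConst ρ) (expSupConst ρ),
    ← ENNReal.ofReal_mul (mul_nonneg (expSupConst_nonneg hρ') hA), mul_assoc,
    ENNReal.ofReal_mul (expSupConst_nonneg hρ'), mul_comm]
  gcongr
  exact lintegral_iSup_exp_sq_sum_div_le hρ hρ' hY hind hsub k

lemma sum_lintegral_iSup_gaussOdds_le (hρ : 0 < ρ) (hρ' : ρ < 1) (hY : ∀ i, Measurable (Y i))
    (hind : iIndepFun Y P) (hsub : ∀ i, HasSubgaussianMGF (Y i) 1 P) {ε : ℝ} (hε : 0 < ε) (T : ℕ) :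
    ∑ k ∈ Icc 1 T, ∫⁻ ω, ⨆ n ∈ Ioc (k / 2) k,
        gaussOdds (√(ρ * n) * (-ε - (∑ i ∈ range n, Y i ω) / n)) ∂P ≤
      ENNReal.ofReal (sampleLossConst ρ / ε ^ 2) := by
  have hκ : 0 < 1 - ρ := sub_pos.2 hρ'
  calc _ ≤ ENNReal.ofReal (oddsConst ρ * expSupConst ρ) *
        ∑ k ∈ Icc 1 T, ENNReal.ofReal (Real.exp (-(k * (ρ * (1 - ρ) / 48 * ε ^ 2)))) := by
        rw [mul_sum]
        exact sum_le_sum fun k _ => lintegral_iSup_gaussOdds_le hρ hρ' hY hind hsub hε.le k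
    _ ≤ ENNReal.ofReal (oddsConst ρ * expSupConst ρ) *
        ENNReal.ofReal (1 / (ρ * (1 - ρ) / 48 * ε ^ 2)) := by
        gcongr
        exact sum_Icc_exp_neg_mul_le (by positivity) T
    _ = _ := by
        rw [← ENNReal.ofReal_mul' (by positivity), sampleLossConst]
        congr 1
        field_simp

end SampleLoss

section Counters

variable {N : ℕ} {σ : State N}

/-- The relations between the counters of the algorithm that hold in every round: an estimate is
based on more than half of the pulls, and every query has raised one level by one. -/
structure State.Inv (σ : State N) : Prop where
  seen_le : ∀ a, σ.seen a ≤ σ.pulls a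
  pulls_lt : ∀ a, σ.pulls a < 2 ^ σ.level a
  level_le : ∀ a, (σ.pulls a = 0 ∧ σ.level a = 0) ∨ 2 ^ σ.level a ≤ 2 * σ.seen a
  batches_eq : σ.batches = ∑ a, σ.level a

lemma State.play_pulls (r : Refresh) (σ : State N) (a : Fin N) :
    (σ.play r a).pulls = Function.update σ.pulls a (σ.pulls a + 1) := by
  unfold State.play
  dsimp only
  split_ifs <;> rfl

lemma State.play_of_lt (r : Refresh) {a : Fin N} (h : σ.pulls a + 1 < 2 ^ σ.level a) :
    σ.play r a = { σ with pulls := Function.update σ.pulls a (σ.pulls a + 1) } := by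
  simp [State.play, h]

lemma State.play_of_le (r : Refresh) {a : Fin N} (h : 2 ^ σ.level a ≤ σ.pulls a + 1) :
    σ.play r a =
      { pulls := Function.update σ.pulls a (σ.pulls a + 1)
        level := Function.update σ.level a (σ.level a + 1)
        seen := match r with
          | .all => Function.update σ.pulls a (σ.pulls a + 1)
          | .trigger => Function.update σ.seen a (σ.pulls a + 1)
        batches := σ.batches + 1 } := by
  simp only [State.play, Function.update_self, h.not_gt, if_false]

lemma State.Inv.play_of_lt (hσ : σ.Inv) (r : Refresh) {a : Fin N}
    (h : σ.pulls a + 1 < 2 ^ σ.level a) : (σ.play r a).Inv := by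
  rw [State.play_of_lt r h]
  refine ⟨fun b => ?_, fun b => ?_, fun b => ?_, hσ.batches_eq⟩ <;>
    rcases eq_or_ne b a with rfl | hb
  · simpa using (hσ.seen_le b).trans (Nat.le_succ _)
  · simpa [hb] using hσ.seen_le b
  · simpa using h
  · simpa [hb] using hσ.pulls_lt b
  · refine (hσ.level_le b).imp_left fun h0 => ?_
    simp [h0.2] at h
  · simpa [hb] using hσ.level_le b

lemma State.Inv.play_of_le (hσ : σ.Inv) (r : Refresh) {a : Fin N}
    (h : 2 ^ σ.level a ≤ σ.pulls a + 1) : (σ.play r a).Inv := by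
  have hlt := hσ.pulls_lt a
  rw [State.play_of_le r h]
  refine ⟨fun b => ?_, fun b => ?_, fun b => ?_, ?_⟩
  · rcases eq_or_ne b a with rfl | hb
    · cases r <;> simp
    · cases r
      · simp
      · simpa [hb] using hσ.seen_le b
  · rcases eq_or_ne b a with rfl | hb
    · simp only [Function.update_self, pow_succ]
      omega
    · simpa [hb] using hσ.pulls_lt b
  · rcases eq_or_ne b a with rfl | hb
    · right
      cases r <;> simp only [Function.update_self, pow_succ] <;> omega
    · have hseen := hσ.seen_le b
      refine (hσ.level_le b).imp (fun h0 => by simpa [hb] using h0) fun h0 => ?_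
      cases r <;> simp only [Function.update_of_ne hb] <;> omega
  · rw [hσ.batches_eq, sum_update_of_mem (mem_univ a), ← add_sum_erase _ _ (mem_univ a),
      sdiff_singleton_eq_erase]
    dsimp only
    omega

lemma State.Inv.play (hσ : σ.Inv) (r : Refresh) (a : Fin N) : (σ.play r a).Inv :=
  (lt_or_ge (σ.pulls a + 1) (2 ^ σ.level a)).elim (hσ.play_of_lt r) (hσ.play_of_le r)

variable (p : Params N) (x : Fin N → ℕ → ℝ) (z : ℕ → Fin N → ℝ)

lemma state_succ (t : ℕ) :
    state p x z (t + 1) = (state p x z t).play p.refresh (arm p x z t) := rfl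

lemma state_inv (t : ℕ) : (state p x z t).Inv := by
  induction t with
  | zero => exact ⟨fun _ => le_rfl, fun _ => by simp [state], fun _ => Or.inl ⟨rfl, rfl⟩,
      by simp [state]⟩
  | succ t ih => exact ih.play _ _

lemma pulls_eq_card (t : ℕ) (a : Fin N) :
    (state p x z t).pulls a = #{s ∈ range t | arm p x z s = a} := by
  induction t with
  | zero => simp [state]
  | succ t ih =>
    rw [state_succ, State.play_pulls, range_add_one, filter_insert]
    rcases eq_or_ne (arm p x z t) a with h | h
    · simp [h, ih]
    · simp [h, h.symm, ih]

lemma pulls_le (t : ℕ) (a : Fin N) : (state p x z t).pulls a ≤ t := by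
  rw [pulls_eq_card]
  exact (card_filter_le _ _).trans (card_range t).le

lemma pulls_lt_pulls {s t : ℕ} (h : s < t) :
    (state p x z s).pulls (arm p x z s) < (state p x z t).pulls (arm p x z s) := by
  rw [pulls_eq_card, pulls_eq_card]
  refine card_lt_card ((ssubset_iff_of_subset ?_).2 ⟨s, by simp [h], by simp⟩)
  exact filter_subset_filter _ (range_subset_range.2 h.le)

lemma injOn_pulls (a : Fin N) :
    Set.InjOn (fun t => (state p x z t).pulls a) {t | arm p x z t = a} := by
  have hmono : StrictMonoOn (fun t => (state p x z t).pulls a) {t | arm p x z t = a} := by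
    rintro s rfl t - h
    exact pulls_lt_pulls p x z h
  exact hmono.injOn

lemma arm_of_lt {t : ℕ} (h : t < N) : arm p x z t = ⟨t, h⟩ := by
  simp [arm, nextArm, h]

lemma pulls_pos {t : ℕ} (h : N ≤ t) (a : Fin N) : 0 < (state p x z t).pulls a := by
  rw [pulls_eq_card, card_pos]
  exact ⟨a, by simp [a.2.trans_le h, arm_of_lt p x z a.2]⟩

lemma pulls_lt_two_mul_seen {t : ℕ} (h : N ≤ t) (a : Fin N) :
    (state p x z t).pulls a < 2 * (state p x z t).seen a := by
  have hlt := (state_inv p x z t).pulls_lt a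
  have hpos := pulls_pos p x z h a
  rcases (state_inv p x z t).level_le a with hlevel | hlevel <;> omega

lemma seen_pos {t : ℕ} (h : N ≤ t) (a : Fin N) : 0 < (state p x z t).seen a := by
  have := pulls_lt_two_mul_seen p x z h a
  omega

lemma seen_mem_Ioc {t : ℕ} (h : N ≤ t) (a : Fin N) :
    (state p x z t).seen a ∈ Ioc ((state p x z t).pulls a / 2) ((state p x z t).pulls a) := by
  have hlt := pulls_lt_two_mul_seen p x z h a
  have hle := (state_inv p x z t).seen_le a
  rw [mem_Ioc]
  omega

lemma level_le_log_succ (t : ℕ) (a : Fin N) : (state p x z t).level a ≤ Nat.log 2 t + 1 := by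
  rcases (state_inv p x z t).level_le a with h | h
  · omega
  rcases Nat.eq_zero_or_eq_succ_pred ((state p x z t).level a) with h0 | h0
  · omega
  have hseen := (state_inv p x z t).seen_le a
  have hpulls := pulls_le p x z t a
  rw [h0, Nat.succ_eq_add_one, pow_succ] at h
  rw [h0]
  exact Nat.succ_le_succ (Nat.le_log_of_pow_le one_lt_two (by omega))

lemma batches_le (t : ℕ) : (state p x z t).batches ≤ N * (Nat.log 2 t + 1) := by
  rw [(state_inv p x z t).batches_eq]
  simpa using sum_le_card_nsmul univ _ _ fun a _ => level_le_log_succ p x z t a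

/- In the rounds in which arm `a` is played, its pull counts are distinct, and each count exceeds
the number of rewards seen by a factor less than two. -/
lemma sum_arm_le_sum_iSup (T : ℕ) (a : Fin N) (f : ℕ → ℝ≥0∞) :
    ∑ t ∈ Ico N T with arm p x z t = a, f ((state p x z t).seen a) ≤
      ∑ k ∈ Icc 1 T, ⨆ n ∈ Ioc (k / 2) k, f n := by
  have hmem : ∀ t ∈ {t ∈ Ico N T | arm p x z t = a}, N ≤ t ∧ t < T ∧ arm p x z t = a := by
    simp [and_assoc]
  calc ∑ t ∈ Ico N T with arm p x z t = a, f ((state p x z t).seen a)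
      ≤ ∑ t ∈ Ico N T with arm p x z t = a,
          ⨆ n ∈ Ioc ((state p x z t).pulls a / 2) ((state p x z t).pulls a), f n :=
        sum_le_sum fun t ht => le_iSup₂_of_le _ (seen_mem_Ioc p x z (hmem t ht).1 a) le_rfl
    _ = ∑ k ∈ {t ∈ Ico N T | arm p x z t = a}.image fun t => (state p x z t).pulls a,
          ⨆ n ∈ Ioc (k / 2) k, f n :=
        (sum_image (f := fun k => ⨆ n ∈ Ioc (k / 2) k, f n)
          ((injOn_pulls p x z a).mono fun t ht => (hmem t ht).2.2)).symm
    _ ≤ _ := by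
        refine sum_le_sum_of_subset (image_subset_iff.2 fun t ht => mem_Icc.2 ?_)
        exact ⟨pulls_pos p x z (hmem t ht).1 a, (pulls_le p x z t a).trans (hmem t ht).2.1.le⟩

end Counters

section Measurability

variable {N : ℕ}

instance : MeasurableSpace (State N) := ⊤

instance : DiscreteMeasurableSpace (State N) := ⟨fun _ => trivial⟩

instance : Countable (State N) :=
  Function.Injective.countable (f := fun σ : State N => (σ.pulls, σ.level, σ.seen, σ.batches))
    fun σ τ h => by cases σ; cases τ; simp_all

lemma measurable_of_countable_param {A B S : Type*} [MeasurableSpace A] [MeasurableSpace B]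
    [MeasurableSpace S] [Countable S] [MeasurableSingletonClass S] {g : S → A → B}
    (hg : ∀ s, Measurable (g s)) {f : A → S} (hf : Measurable f) : Measurable fun a => g (f a) a :=
  (measurable_from_prod_countable_right (f := fun q : S × A => g q.1 q.2) hg).comp
    (hf.prodMk measurable_id)

@[fun_prop]
lemma measurable_empMean (n : ℕ) : Measurable fun x : ℕ → ℝ => empMean x n := by
  unfold empMean
  fun_prop

@[fun_prop]
lemma measurable_clipLevel (N T : ℕ) (α : ℝ) (n : ℕ) :
    Measurable fun x : ℕ → ℝ => clipLevel N T α x n := by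
  unfold clipLevel
  fun_prop

lemma measurable_clippedSample (N T : ℕ) (ρ α : ℝ) (n : ℕ) :
    Measurable fun q : (ℕ → ℝ) × ℝ => clippedSample N T ρ α q.1 n q.2 := by
  unfold clippedSample
  fun_prop

/-- The data on which the algorithm runs: the rewards of all pulls and the noise of all rounds. -/
abbrev Input (N : ℕ) := (Fin N → ℕ → ℝ) × (ℕ → Fin N → ℝ)

/-- The sample on which the choice of the arm in round `t` is based. -/
noncomputable def sample (p : Params N) (q : Input N) (t : ℕ) (a : Fin N) : ℝ :=
  clippedSample N p.T p.ρ p.α (q.1 a) ((state p q.1 q.2 t).seen a) (q.2 t a)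

lemma arm_of_le (p : Params N) (q : Input N) {t : ℕ} (h : N ≤ t) :
    arm p q.1 q.2 t = p.argmax (sample p q t) := by
  simp only [arm, nextArm, h.not_gt, dif_neg, not_false_eq_true]
  rfl

variable {p : Params N}

lemma measurable_clippedSample_input (t n : ℕ) (a : Fin N) :
    Measurable fun q : Input N => clippedSample N p.T p.ρ p.α (q.1 a) n (q.2 t a) :=
  (measurable_clippedSample N p.T p.ρ p.α n).comp
    (Measurable.prodMk (by fun_prop) (by fun_prop) : Measurable fun q : Input N => (q.1 a, q.2 t a))

lemma measurable_nextArm (hp : Measurable p.argmax) (t : ℕ) (σ : State N) :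
    Measurable fun q : Input N => nextArm p q.1 q.2 t σ := by
  unfold nextArm
  split_ifs
  · exact measurable_const
  · exact hp.comp (measurable_pi_lambda _ fun a => measurable_clippedSample_input t (σ.seen a) a)

lemma measurable_state (hp : Measurable p.argmax) (t : ℕ) :
    Measurable fun q : Input N => state p q.1 q.2 t := by
  induction t with
  | zero => exact measurable_const
  | succ t ih =>
    have harm := measurable_of_countable_param (measurable_nextArm hp t) ih
    exact measurable_of_countable_param
      (g := fun σ (q : Input N) => State.play p.refresh σ (nextArm p q.1 q.2 t (state p q.1 q.2 t)))
      (fun σ => (Measurable.of_discrete (f := State.play p.refresh σ)).comp harm) ih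

lemma measurable_arm (hp : Measurable p.argmax) (t : ℕ) :
    Measurable fun q : Input N => arm p q.1 q.2 t :=
  measurable_of_countable_param (measurable_nextArm hp t) (measurable_state hp t)

lemma measurableSet_arm_eq (hp : Measurable p.argmax) (t : ℕ) (a : Fin N) :
    MeasurableSet {q : Input N | arm p q.1 q.2 t = a} :=
  measurable_arm hp t (measurableSet_singleton a)

lemma measurable_sample (hp : Measurable p.argmax) (t : ℕ) (a : Fin N) :
    Measurable fun q : Input N => sample p q t a :=
  measurable_of_countable_param
    (g := fun (σ : State N) (q : Input N) =>
      clippedSample N p.T p.ρ p.α (q.1 a) (σ.seen a) (q.2 t a))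
    (fun σ => measurable_clippedSample_input t (σ.seen a) a) (measurable_state hp t)

end Measurability

section Resampling

lemma indepFun_restrict_of_disjoint {Ω ι : Type*} {E : ι → Type*} [MeasurableSpace Ω]
    [∀ i, MeasurableSpace (E i)] {P : Measure Ω} {f : ∀ i, Ω → E i} (hf : ∀ i, Measurable (f i))
    (h : iIndepFun f P) {S T : Set ι} (hST : Disjoint S T) :
    IndepFun (fun ω (i : S) => f i ω) (fun ω (i : T) => f i ω) P := by
  rw [IndepFun_iff_Indep, MeasurableSpace.comap_process_pi fun i : S => f i,
    MeasurableSpace.comap_process_pi fun i : T => f i]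
  have hiSup := indep_iSup_of_disjoint (fun i => (hf i).comap_le) h.iIndep hST
  simp only [iSup_subtype'] at hiSup
  exact hiSup

variable {N : ℕ}

/-- The law of the noise of one round. -/
noncomputable abbrev noiseLaw (N : ℕ) : Measure (Fin N → ℝ) :=
  Measure.pi fun _ => gaussianReal 0 1

/-- The input `q` with the noise of round `t` replaced by `w`. -/
def renoise (t : ℕ) (q : Input N) (w : Fin N → ℝ) : Input N := (q.1, Function.update q.2 t w)

lemma renoise_renoise (t : ℕ) (q : Input N) (v w : Fin N → ℝ) :
    renoise t (renoise t q v) w = renoise t q w := by simp [renoise]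

lemma renoise_self (t : ℕ) (q : Input N) : renoise t q (q.2 t) = q := by simp [renoise]

@[fun_prop]
lemma measurable_renoise (t : ℕ) :
    Measurable fun q : Input N × (Fin N → ℝ) => renoise t q.1 q.2 := by
  unfold renoise
  exact measurable_fst.fst.prodMk
    (measurable_update'.comp (measurable_fst.snd.prodMk measurable_snd))

lemma state_congr (p : Params N) (x : Fin N → ℕ → ℝ) {z z' : ℕ → Fin N → ℝ} {t : ℕ}
    (h : ∀ s < t, z s = z' s) : state p x z t = state p x z' t := by
  induction t with
  | zero => rfl
  | succ t ih =>
    simp only [state, nextArm, ih fun s hs => h s (hs.trans t.lt_succ_self), h t t.lt_succ_self]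

lemma state_renoise (p : Params N) (t : ℕ) (q : Input N) (w : Fin N → ℝ) :
    state p (renoise t q w).1 (renoise t q w).2 t = state p q.1 q.2 t :=
  state_congr p q.1 fun _ hs => Function.update_of_ne hs.ne _ _

variable {Ω : Type*} [MeasurableSpace Ω] {P : Measure Ω} {ν : Fin N → Measure ℝ}
  {X : Fin N → ℕ → Ω → ℝ} {Z : ℕ → Fin N → Ω → ℝ}

/-- The input of the algorithm in the outcome `ω`. -/
def input (X : Fin N → ℕ → Ω → ℝ) (Z : ℕ → Fin N → Ω → ℝ) (ω : Ω) : Input N :=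
  (fun a i => X a i ω, fun t a => Z t a ω)

lemma IsModel.measurable_input (h : IsModel P ν X Z) : Measurable (input X Z) :=
  (measurable_pi_lambda _ fun a => measurable_pi_lambda _ fun i => h.measurable_reward a i).prodMk
    (measurable_pi_lambda _ fun t => measurable_pi_lambda _ fun a => h.measurable_noise t a)

lemma IsModel.measurable_noise_round (h : IsModel P ν X Z) (t : ℕ) :
    Measurable fun ω => (input X Z ω).2 t :=
  measurable_pi_lambda _ (h.measurable_noise t)

lemma IsModel.map_noise_round (h : IsModel P ν X Z) (t : ℕ) :
    P.map (fun ω => (input X Z ω).2 t) = noiseLaw N := by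
  have hindep : iIndepFun (Z t) P := h.indep.precomp (g := fun a : Fin N => Sum.inr (t, a))
    fun a b hab => by simpa using hab
  have := h.indep.isProbabilityMeasure
  exact (hindep.hasLaw_pi fun a => h.law_noise t a).map_eq

lemma IsModel.indepFun_renoise_noise_round (h : IsModel P ν X Z) (t : ℕ) :
    IndepFun (fun ω => renoise t (input X Z ω) 0) (fun ω => (input X Z ω).2 t) P := by
  set S : Set ((Fin N × ℕ) ⊕ (ℕ × Fin N)) := Set.range fun a => Sum.inr (t, a) with hS
  have hmeas : ∀ i, Measurable
      (Sum.elim (fun q : Fin N × ℕ => X q.1 q.2) (fun q : ℕ × Fin N => Z q.1 q.2) i) :=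
    Sum.rec (fun q => h.measurable_reward q.1 q.2) fun q => h.measurable_noise q.1 q.2
  let rest : (↥Sᶜ → ℝ) → Input N := fun v =>
    (fun a i => v ⟨Sum.inl (a, i), by simp [hS]⟩,
      fun s a => if hs : s = t then 0 else v ⟨Sum.inr (s, a), by simp [hS, Ne.symm hs]⟩)
  let noise : (S → ℝ) → Fin N → ℝ := fun v a => v ⟨Sum.inr (t, a), by simp [hS]⟩
  have hrest : Measurable rest := by
    refine Measurable.prodMk (by fun_prop)
      (measurable_pi_lambda _ fun s => measurable_pi_lambda _ fun a => ?_)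
    split_ifs <;> fun_prop
  have hnoise : Measurable noise := by fun_prop
  convert (indepFun_restrict_of_disjoint hmeas h.indep disjoint_compl_left).comp hrest hnoise
    using 1
  · ext1 ω
    refine Prod.ext rfl (funext₂ fun s a => ?_)
    rcases eq_or_ne s t with rfl | hs
    · simp [renoise, rest]
    · simp [renoise, rest, input, hs]
  · rfl

lemma IsModel.lintegral_renoise (h : IsModel P ν X Z) (t : ℕ) {F : Input N → ℝ≥0∞}
    (hF : Measurable F) :
    ∫⁻ ω, F (input X Z ω) ∂P = ∫⁻ ω, ∫⁻ w, F (renoise t (input X Z ω) w) ∂noiseLaw N ∂P := by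
  set H : Ω → Input N := fun ω => renoise t (input X Z ω) 0 with hH
  have hHm : Measurable H := by
    have := h.measurable_input
    fun_prop
  have hWm := h.measurable_noise_round t
  have hG : Measurable fun q : Input N × (Fin N → ℝ) => F (renoise t q.1 q.2) := by fun_prop
  have := h.indep.isProbabilityMeasure
  have hjoint := (indepFun_iff_map_prod_eq_prod_map_map hHm.aemeasurable hWm.aemeasurable).1
    (h.indepFun_renoise_noise_round t)
  calc ∫⁻ ω, F (input X Z ω) ∂P
      = ∫⁻ ω, F (renoise t (H ω) ((input X Z ω).2 t)) ∂P := by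
        simp only [hH, renoise_renoise, renoise_self]
    _ = ∫⁻ q, F (renoise t q.1 q.2) ∂(P.map fun ω => (H ω, (input X Z ω).2 t)) :=
        (lintegral_map hG (hHm.prodMk hWm)).symm
    _ = ∫⁻ q, ∫⁻ w, F (renoise t q w) ∂noiseLaw N ∂(P.map H) := by
        rw [hjoint, h.map_noise_round, lintegral_prod _ hG.aemeasurable]
    _ = ∫⁻ ω, ∫⁻ w, F (renoise t (H ω) w) ∂noiseLaw N ∂P :=
        lintegral_map hG.lintegral_prod_right' hHm
    _ = _ := by simp only [hH, renoise_renoise]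

end Resampling

section Rounds

lemma pi_forall_le_le_div_mul_pi_argmax_eq {ι β : Type*} [Fintype ι] [LinearOrder β] {E : ι → Type*}
    [∀ b, MeasurableSpace (E b)] {μ : ∀ b, Measure (E b)} [∀ b, IsFiniteMeasure (μ b)]
    {argmax : (ι → β) → ι} (hmax : ∀ (θ : ι → β) b, θ b ≤ θ (argmax θ)) (g : ∀ b, E b → β)
    {s : ι} {y : β} (hs : μ s {u | y < g s u} ≠ 0) :
    Measure.pi μ {w | ∀ b, g b (w b) ≤ y} ≤ μ s {u | g s u ≤ y} / μ s {u | y < g s u} *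
      Measure.pi μ {w | argmax (fun b => g b (w b)) = s} := by
  classical
  set low : ∀ b, Set (E b) := fun b => {u | g b u ≤ y} with hlow
  set high : Set (E s) := {u | y < g s u}
  have hall : {w : ∀ b, E b | ∀ b, g b (w b) ≤ y} = Set.univ.pi low := by
    ext; simp [hlow]
  have hsub : Set.univ.pi (Function.update low s high) ⊆
      {w | argmax (fun b => g b (w b)) = s} := by
    intro w hw
    by_contra hne
    have hs := hw s (Set.mem_univ _)
    have hb := hw (argmax fun b => g b (w b)) (Set.mem_univ _)
    rw [Function.update_self] at hs
    rw [Function.update_of_ne hne] at hb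
    exact ((hmax (fun b => g b (w b)) s).trans hb).not_gt hs
  have hrest : ∏ b ∈ univ.erase s, μ b (Function.update low s high b) =
      ∏ b ∈ univ.erase s, μ b (low b) :=
    prod_congr rfl fun b hb => by rw [Function.update_of_ne (ne_of_mem_erase hb)]
  calc Measure.pi μ {w | ∀ b, g b (w b) ≤ y}
      = μ s (low s) * ∏ b ∈ univ.erase s, μ b (low b) := by
        rw [hall, Measure.pi_pi, mul_prod_erase _ (fun b => μ b (low b)) (mem_univ s)]
    _ = μ s (low s) / μ s high * (μ s high * ∏ b ∈ univ.erase s, μ b (low b)) := by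
        rw [← mul_assoc, ENNReal.div_mul_cancel hs (measure_ne_top _ _)]
    _ = μ s (low s) / μ s high * Measure.pi μ (Set.univ.pi (Function.update low s high)) := by
        rw [Measure.pi_pi, ← mul_prod_erase _ _ (mem_univ s), Function.update_self, hrest]
    _ ≤ _ := by gcongr

variable {N : ℕ}

lemma clippedSample_le_iff {T : ℕ} {ρ α : ℝ} {x : ℕ → ℝ} {n : ℕ} (hρ : 0 < ρ) (hn : 0 < n)
    {y : ℝ} (hy : y < clipLevel N T α x n) (u : ℝ) :
    clippedSample N T ρ α x n u ≤ y ↔ u ≤ √(ρ * n) * (y - empMean x n) := by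
  have hr : 0 < √(ρ * n) := by positivity
  rw [clippedSample, min_le_iff, or_iff_left hy.not_ge, ← le_sub_iff_add_le', div_le_iff₀' hr]

/-- The inputs for which the clipping levels of arm `s` all exceed `y`. -/
def levelsAbove (p : Params N) (s : Fin N) (y : ℝ) : Set (Input N) :=
  {q | ∀ n ∈ Icc 1 p.T, y < clipLevel N p.T p.α (q.1 s) n}

lemma measurableSet_levelsAbove (p : Params N) (s : Fin N) (y : ℝ) :
    MeasurableSet (levelsAbove p s y) := by
  simp only [levelsAbove, Set.ofPred_forall]
  exact Finset.measurableSet_biInter _ fun n _ => measurableSet_lt measurable_const (by fun_prop)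

/-- The inputs for which arm `i` is played in round `t` although its sample is at most `y`. -/
def lowPlay (p : Params N) (i : Fin N) (y : ℝ) (t : ℕ) : Set (Input N) :=
  {q | arm p q.1 q.2 t = i ∧ sample p q t i ≤ y}

/-- The odds that the unclipped sample of an arm with rewards `x`, based on the first `n` of them,
is at most `y`. -/
noncomputable def sampleOdds (ρ y : ℝ) (x : ℕ → ℝ) (n : ℕ) : ℝ≥0∞ :=
  gaussOdds (√(ρ * n) * (y - empMean x n))

@[fun_prop]
lemma measurable_sampleOdds (ρ y : ℝ) (n : ℕ) : Measurable fun x => sampleOdds ρ y x n := by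
  have := monotone_gaussOdds.measurable
  unfold sampleOdds
  fun_prop

/-- The odds that the unclipped sample of arm `s` in round `t` is at most `y`, if this arm is
played, and `0` otherwise. -/
noncomputable def playOdds (p : Params N) (s : Fin N) (y : ℝ) (t : ℕ) : Input N → ℝ≥0∞ :=
  {q | arm p q.1 q.2 t = s}.indicator fun q =>
    sampleOdds p.ρ y (q.1 s) ((state p q.1 q.2 t).seen s)

variable {p : Params N}

lemma measurableSet_lowPlay (hp : Measurable p.argmax) (i : Fin N) (y : ℝ) (t : ℕ) :
    MeasurableSet (lowPlay p i y t) :=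
  (measurableSet_arm_eq hp t i).inter (measurableSet_le (measurable_sample hp t i) measurable_const)

lemma measurable_playOdds (hp : Measurable p.argmax) (s : Fin N) (y : ℝ) (t : ℕ) :
    Measurable (playOdds p s y t) :=
  (measurable_of_countable_param
    (g := fun (σ : State N) (q : Input N) => sampleOdds p.ρ y (q.1 s) (σ.seen s))
    (fun σ => by fun_prop) (measurable_state hp t)).indicator (measurableSet_arm_eq hp t s)

lemma sample_renoise (p : Params N) (t : ℕ) (q : Input N) (w : Fin N → ℝ) (a : Fin N) :
    sample p (renoise t q w) t a =
      clippedSample N p.T p.ρ p.α (q.1 a) ((state p q.1 q.2 t).seen a) (w a) := by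
  rw [sample, state_renoise]
  simp [renoise]

lemma noiseLaw_lowPlay_le (hmax : ∀ (θ : Fin N → ℝ) b, θ b ≤ θ (p.argmax θ)) (hρ : 0 < p.ρ) {t : ℕ}
    (hNt : N ≤ t) (htT : t < p.T) {s : Fin N} {y : ℝ} {q : Input N} (hq : q ∈ levelsAbove p s y)
    (i : Fin N) :
    noiseLaw N {w | renoise t q w ∈ lowPlay p i y t} ≤
      sampleOdds p.ρ y (q.1 s) ((state p q.1 q.2 t).seen s) *
        noiseLaw N {w | arm p (renoise t q w).1 (renoise t q w).2 t = s} := by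
  set n := (state p q.1 q.2 t).seen s
  have hn0 : 0 < n := seen_pos p q.1 q.2 hNt s
  have hnT : n ≤ p.T :=
    ((state_inv p q.1 q.2 t).seen_le s).trans ((pulls_le p q.1 q.2 t s).trans htT.le)
  set g : Fin N → ℝ → ℝ := fun a =>
    clippedSample N p.T p.ρ p.α (q.1 a) ((state p q.1 q.2 t).seen a)
  have harm : ∀ w, arm p (renoise t q w).1 (renoise t q w).2 t = p.argmax fun a => g a (w a) :=
    fun w => (arm_of_le p _ hNt).trans (congrArg p.argmax (funext (sample_renoise p t q w)))
  have hlow : {u | g s u ≤ y} = Set.Iic (√(p.ρ * n) * (y - empMean (q.1 s) n)) :=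
    Set.ext (clippedSample_le_iff hρ hn0 (hq n (mem_Icc.2 ⟨hn0, hnT⟩)))
  have hhigh : {u | y < g s u} = Set.Ioi (√(p.ρ * n) * (y - empMean (q.1 s) n)) := by
    rw [← Set.compl_Iic, ← hlow]
    ext u
    simp
  have hsub : {w | renoise t q w ∈ lowPlay p i y t} ⊆ {w | ∀ a, g a (w a) ≤ y} := by
    rintro w ⟨hi, hle⟩ a
    rw [sample_renoise] at hle
    rw [harm] at hi
    exact (hmax (fun a => g a (w a)) a).trans (by rwa [hi])
  calc noiseLaw N {w | renoise t q w ∈ lowPlay p i y t}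
      ≤ noiseLaw N {w | ∀ a, g a (w a) ≤ y} := measure_mono hsub
    _ ≤ _ := pi_forall_le_le_div_mul_pi_argmax_eq hmax g (by
        rw [hhigh]; exact gaussianReal_Ioi_ne_zero _)
    _ = _ := by simp only [hlow, hhigh, harm, sampleOdds, gaussOdds]

variable {Ω : Type*} [MeasurableSpace Ω] {P : Measure Ω} {ν : Fin N → Measure ℝ}
  {X : Fin N → ℕ → Ω → ℝ} {Z : ℕ → Fin N → Ω → ℝ}

lemma IsModel.lintegral_indicator_lowPlay_le (h : IsModel P ν X Z) (hp : Measurable p.argmax)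
    (hmax : ∀ (θ : Fin N → ℝ) b, θ b ≤ θ (p.argmax θ)) (hρ : 0 < p.ρ)
    {t : ℕ} (hNt : N ≤ t) (htT : t < p.T) (s i : Fin N) (y : ℝ) :
    ∫⁻ ω, (levelsAbove p s y ∩ lowPlay p i y t).indicator 1 (input X Z ω) ∂P ≤
      ∫⁻ ω, playOdds p s y t (input X Z ω) ∂P := by
  have hlow := (measurableSet_levelsAbove p s y).inter (measurableSet_lowPlay hp i y t)
  rw [h.lintegral_renoise t (measurable_one.indicator hlow),
    h.lintegral_renoise t (measurable_playOdds hp s y t)]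
  refine lintegral_mono fun ω => ?_
  generalize input X Z ω = q
  have hr : Measurable (renoise t q) := by fun_prop
  by_cases hq : q ∈ levelsAbove p s y
  · calc ∫⁻ w, (levelsAbove p s y ∩ lowPlay p i y t).indicator 1 (renoise t q w) ∂noiseLaw N
        = noiseLaw N (renoise t q ⁻¹' (levelsAbove p s y ∩ lowPlay p i y t)) :=
          lintegral_indicator_one (hr hlow)
      _ ≤ noiseLaw N {w | renoise t q w ∈ lowPlay p i y t} := measure_mono fun w hw => hw.2
      _ ≤ sampleOdds p.ρ y (q.1 s) ((state p q.1 q.2 t).seen s) *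
            noiseLaw N {w | arm p (renoise t q w).1 (renoise t q w).2 t = s} :=
          noiseLaw_lowPlay_le hmax hρ hNt htT hq i
      _ = ∫⁻ w, playOdds p s y t (renoise t q w) ∂noiseLaw N := by
          refine (lintegral_indicator_const (hr (measurableSet_arm_eq hp t s)) _).symm.trans
            (lintegral_congr fun w => ?_)
          change _ = (renoise t q ⁻¹' {q | arm p q.1 q.2 t = s}).indicator (fun w =>
            sampleOdds p.ρ y (q.1 s) ((state p (renoise t q w).1 (renoise t q w).2 t).seen s)) w
          simp only [state_renoise]
  · have hzero : ∀ w, (levelsAbove p s y ∩ lowPlay p i y t).indicator (1 : Input N → ℝ≥0∞)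
        (renoise t q w) = 0 := fun w => Set.indicator_of_notMem (fun hw => hq hw.1) _
    simp [hzero]

/-- The number of rounds after the initial ones in which arm `i` is played. -/
noncomputable def latePlays (p : Params N) (i : Fin N) (q : Input N) : ℝ≥0∞ :=
  ∑ t ∈ Ico N p.T, {q | arm p q.1 q.2 t = i}.indicator 1 q

lemma sum_playOdds_le (p : Params N) (q : Input N) (s : Fin N) (y : ℝ) :
    ∑ t ∈ Ico N p.T, playOdds p s y t q ≤
      ∑ k ∈ Icc 1 p.T, ⨆ n ∈ Ioc (k / 2) k, sampleOdds p.ρ y (q.1 s) n := by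
  refine (le_of_eq ?_).trans (sum_arm_le_sum_iSup p q.1 q.2 p.T s (sampleOdds p.ρ y (q.1 s)))
  simp only [playOdds, sum_filter, Set.indicator_apply, Set.mem_ofPred_eq]

/- A play of `i` with a sample above `y` requires a clipping level above `y`. -/
lemma latePlays_le (p : Params N) (i : Fin N) (y : ℝ) (q : Input N) :
    latePlays p i q ≤ ∑ t ∈ Ico N p.T, (lowPlay p i y t).indicator 1 q +
      ∑ k ∈ Icc 1 p.T, {q : Input N | ∃ n ∈ Ioc (k / 2) k,
        y < clipLevel N p.T p.α (q.1 i) n}.indicator 1 q := by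
  set f : ℕ → ℝ≥0∞ := {n | y < clipLevel N p.T p.α (q.1 i) n}.indicator 1 with hf
  have hround : ∀ t ∈ Ico N p.T, {q | arm p q.1 q.2 t = i}.indicator (1 : Input N → ℝ≥0∞) q ≤
      (lowPlay p i y t).indicator 1 q +
        if arm p q.1 q.2 t = i then f ((state p q.1 q.2 t).seen i) else 0 := by
    intro t _
    by_cases ha : arm p q.1 q.2 t = i
    · by_cases hle : sample p q t i ≤ y
      · have : q ∈ lowPlay p i y t := ⟨ha, hle⟩
        simp [this, ha]
      · have : y < clipLevel N p.T p.α (q.1 i) ((state p q.1 q.2 t).seen i) :=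
          (not_le.1 hle).trans_le (min_le_right _ _)
        simp [this, ha, hf]
    · simp [ha]
  refine (sum_le_sum hround).trans ?_
  rw [sum_add_distrib, ← sum_filter]
  gcongr
  refine (sum_arm_le_sum_iSup p q.1 q.2 p.T i f).trans (sum_le_sum fun k _ => ?_)
  refine iSup₂_le fun n hn => ?_
  by_cases hy : y < clipLevel N p.T p.α (q.1 i) n
  · rw [Set.indicator_of_mem (by exact ⟨n, hn, hy⟩)]
    exact Set.indicator_le_self' (fun _ _ => zero_le_one) n
  · simp [hf, hy]

lemma measurable_latePlays (hp : Measurable p.argmax) (i : Fin N) : Measurable (latePlays p i) :=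
  Finset.measurable_fun_sum _ fun t _ => measurable_one.indicator (measurableSet_arm_eq hp t i)

lemma IsModel.lintegral_indicator_latePlays_le (h : IsModel P ν X Z) (hp : Measurable p.argmax)
    (hmax : ∀ (θ : Fin N → ℝ) b, θ b ≤ θ (p.argmax θ)) (hρ : 0 < p.ρ) (s i : Fin N) (y : ℝ) :
    ∫⁻ ω, (levelsAbove p s y).indicator (latePlays p i) (input X Z ω) ∂P ≤
      ∑ k ∈ Icc 1 p.T, ∫⁻ ω, ⨆ n ∈ Ioc (k / 2) k, sampleOdds p.ρ y (fun j => X s j ω) n ∂P +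
      ∑ k ∈ Icc 1 p.T,
        P {ω | ∃ n ∈ Ioc (k / 2) k, y < clipLevel N p.T p.α (fun j => X i j ω) n} := by
  have hin := h.measurable_input
  set low : ℕ → Set (Input N) := fun t => levelsAbove p s y ∩ lowPlay p i y t
  set high : ℕ → Set (Input N) := fun k =>
    {q | ∃ n ∈ Ioc (k / 2) k, y < clipLevel N p.T p.α (q.1 i) n}
  have hlow : ∀ t, MeasurableSet (low t) := fun t =>
    (measurableSet_levelsAbove p s y).inter (measurableSet_lowPlay hp i y t)
  have hhigh : ∀ k, MeasurableSet (high k) := fun k => by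
    have : high k = ⋃ n ∈ Ioc (k / 2) k, {q | y < clipLevel N p.T p.α (q.1 i) n} := by
      ext; simp [high]
    rw [this]
    exact Finset.measurableSet_biUnion _ fun n _ => measurableSet_lt measurable_const (by fun_prop)
  have hlow' : ∀ t, Measurable fun ω => (low t).indicator (1 : Input N → ℝ≥0∞) (input X Z ω) :=
    fun t => (measurable_one.indicator (hlow t)).comp hin
  have hhigh' : ∀ k, Measurable fun ω => (high k).indicator (1 : Input N → ℝ≥0∞) (input X Z ω) :=
    fun k => (measurable_one.indicator (hhigh k)).comp hin
  have hodds : ∀ t, Measurable fun ω => playOdds p s y t (input X Z ω) :=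
    fun t => (measurable_playOdds hp s y t).comp hin
  have hsplit : ∀ q, (levelsAbove p s y).indicator (latePlays p i) q ≤
      ∑ t ∈ Ico N p.T, (low t).indicator 1 q + ∑ k ∈ Icc 1 p.T, (high k).indicator 1 q := by
    refine fun q => Set.indicator_apply_le' (fun hq => (latePlays_le p i y q).trans_eq ?_)
      fun _ => zero_le
    simp only [low, Set.inter_indicator_one, Pi.mul_apply, Set.indicator_of_mem hq, Pi.one_apply,
      one_mul, high]
  calc _ ≤ ∑ t ∈ Ico N p.T, ∫⁻ ω, (low t).indicator 1 (input X Z ω) ∂P +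
          ∑ k ∈ Icc 1 p.T, ∫⁻ ω, (high k).indicator 1 (input X Z ω) ∂P := by
        rw [← lintegral_finsetSum _ fun t _ => hlow' t, ← lintegral_finsetSum _ fun k _ =>
          hhigh' k, ← lintegral_add_left (by fun_prop)]
        exact lintegral_mono fun ω => hsplit _
    _ ≤ ∑ t ∈ Ico N p.T, ∫⁻ ω, playOdds p s y t (input X Z ω) ∂P +
          ∑ k ∈ Icc 1 p.T, P (input X Z ⁻¹' high k) := by
        refine add_le_add (sum_le_sum fun t ht => ?_) (sum_le_sum fun k _ => ?_)
        · exact h.lintegral_indicator_lowPlay_le hp hmax hρ (mem_Ico.1 ht).1 (mem_Ico.1 ht).2 s i y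
        · exact lintegral_indicator_one_le (input X Z ⁻¹' high k)
    _ ≤ _ := by
        gcongr ?_ + _
        · rw [← lintegral_finsetSum _ fun t _ => hodds t, ← lintegral_finsetSum]
          · exact lintegral_mono fun ω => sum_playOdds_le p _ s y
          · exact fun k _ => Measurable.iSup fun n => Measurable.iSup fun _ =>
              (measurable_sampleOdds p.ρ y n).comp (hin.fst.eval)

end Rounds

section Regret

variable {N : ℕ}

lemma gap_nonneg (ν : Fin N → Measure ℝ) (a : Fin N) : 0 ≤ gap ν a :=
  sub_nonneg.2 (le_ciSup (Set.finite_range _).bddAbove a)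

lemma exists_gap_eq_mean_sub_mean [Nonempty (Fin N)] (ν : Fin N → Measure ℝ) :
    ∃ s, ∀ a, gap ν a = mean ν s - mean ν a := by
  obtain ⟨s, hs⟩ := exists_eq_ciSup_of_finite (f := mean ν)
  exact ⟨s, fun a => by rw [gap, ← hs]⟩

lemma regret_nonneg (p : Params N) (ν : Fin N → Measure ℝ) (x : Fin N → ℕ → ℝ)
    (z : ℕ → Fin N → ℝ) : 0 ≤ regret p ν x z :=
  sum_nonneg fun _ _ => gap_nonneg _ _

lemma regret_le (p : Params N) {ν : Fin N → Measure ℝ} {c : ℝ} (hc : ∀ a, gap ν a ≤ c)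
    (x : Fin N → ℕ → ℝ) (z : ℕ → Fin N → ℝ) : regret p ν x z ≤ p.T * c :=
  (sum_le_card_nsmul _ _ c fun _ _ => hc _).trans_eq (by simp)

lemma ofReal_regret_le (p : Params N) (ν : Fin N → Measure ℝ) (q : Input N) :
    ENNReal.ofReal (regret p ν q.1 q.2) ≤ ∑ a, ENNReal.ofReal (gap ν a) +
      ∑ t ∈ Ico N p.T, ENNReal.ofReal (gap ν (arm p q.1 q.2 t)) := by
  have hinit : ∑ a, ENNReal.ofReal (gap ν a) =
      ∑ t ∈ range N, ENNReal.ofReal (gap ν (arm p q.1 q.2 t)) := by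
    rw [sum_range]
    exact sum_congr rfl fun a _ => by rw [arm_of_lt p q.1 q.2 a.2]
  have hsub : range p.T ⊆ range N ∪ Ico N p.T := fun t ht => by
    simp only [mem_union, mem_range, mem_Ico] at ht ⊢
    omega
  rw [regret, ENNReal.ofReal_sum_of_nonneg fun _ _ => gap_nonneg _ _, hinit]
  refine (sum_le_sum_of_subset hsub).trans (sum_union ?_).le
  exact disjoint_left.2 fun t ht ht' => (mem_range.1 ht).not_ge (mem_Ico.1 ht').1

lemma measurable_regret {p : Params N} (hp : Measurable p.argmax) (ν : Fin N → Measure ℝ) :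
    Measurable fun q : Input N => regret p ν q.1 q.2 :=
  Finset.measurable_fun_sum _ fun t _ =>
    (Measurable.of_discrete (f := gap ν)).comp (measurable_arm hp t)

variable {Ω : Type*} [MeasurableSpace Ω] {P : Measure Ω} {ν : Fin N → Measure ℝ}
  {X : Fin N → ℕ → Ω → ℝ} {Z : ℕ → Fin N → Ω → ℝ} {p : Params N}

lemma IsModel.isProbabilityMeasure (h : IsModel P ν X Z) : IsProbabilityMeasure P :=
  h.indep.isProbabilityMeasure

lemma IsModel.integrable_regret (h : IsModel P ν X Z) (hp : Measurable p.argmax) :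
    Integrable (fun ω => regret p ν (input X Z ω).1 (input X Z ω).2) P := by
  have := h.isProbabilityMeasure
  refine Integrable.of_bound
    ((measurable_regret hp ν).comp h.measurable_input).aestronglyMeasurable
    (p.T * ∑ a, gap ν a) (ae_of_all _ fun ω => ?_)
  rw [Real.norm_of_nonneg (regret_nonneg _ _ _ _)]
  exact regret_le p (fun a => single_le_sum (fun b _ => gap_nonneg ν b) (mem_univ a)) _ _

lemma IsModel.measurable_sub_mean (h : IsModel P ν X Z) (a : Fin N) (i : ℕ) :
    Measurable fun ω => X a i ω - mean ν a :=
  (h.measurable_reward a i).sub_const _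

lemma IsModel.iIndepFun_sub_mean (h : IsModel P ν X Z) (a : Fin N) :
    iIndepFun (fun i ω => X a i ω - mean ν a) P := by
  have hX : iIndepFun (X a) P := h.indep.precomp (g := fun i : ℕ => Sum.inl (a, i))
    fun i j hij => by simpa using hij
  exact hX.comp (fun _ y => y - mean ν a) fun _ => measurable_id.sub_const _

lemma IsModel.hasSubgaussianMGF_sub_mean (h : IsModel P ν X Z) (a : Fin N) (i : ℕ) :
    HasSubgaussianMGF (fun ω => X a i ω - mean ν a) 1 P := by
  have hν := h.subgaussian a
  rw [← (h.law_reward a i).map_eq] at hν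
  exact HasSubgaussianMGF.of_map (h.measurable_reward a i).aemeasurable hν

lemma IsModel.measure_compl_levelsAbove_le (h : IsModel P ν X Z) (hα : 4 ≤ p.α) (hT : 0 < p.T)
    (s : Fin N) {δ : ℝ} (hδ : 0 < δ) :
    P (input X Z ⁻¹' (levelsAbove p s (mean ν s - δ))ᶜ) ≤
      ENNReal.ofReal (24 * N / (p.T * δ ^ 2)) := by
  have := h.isProbabilityMeasure
  refine (measure_mono fun ω hω => ?_).trans (measure_exists_clipLevel_le (h.measurable_sub_mean s)
    (h.iIndepFun_sub_mean s) (h.hasSubgaussianMGF_sub_mean s) hα s.pos hT hδ)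
  simp only [levelsAbove, Set.mem_preimage, Set.mem_compl_iff, Set.mem_ofPred_eq, not_forall,
    not_lt] at hω
  obtain ⟨n, hn, hle⟩ := hω
  refine ⟨n, hn, ?_⟩
  rw [clipLevel_sub_const (x := fun i => X s i ω) _ (Nat.one_le_iff_ne_zero.1 (mem_Icc.1 hn).1)]
  change clipLevel N p.T p.α (fun i => X s i ω) n ≤ mean ν s - δ at hle
  linarith

lemma IsModel.lintegral_indicator_latePlays_le_ofReal (h : IsModel P ν X Z)
    (hp : Measurable p.argmax) (hmax : ∀ (θ : Fin N → ℝ) b, θ b ≤ θ (p.argmax θ)) (hρ : 0 < p.ρ)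
    (hρ' : p.ρ < 1) (hα : 0 ≤ p.α) {s i : Fin N} {δ : ℝ} (hδ : 0 < δ)
    (hgap : mean ν s - mean ν i = 2 * δ) :
    ∫⁻ ω, (levelsAbove p s (mean ν s - δ)).indicator (latePlays p i) (input X Z ω) ∂P ≤
      ENNReal.ofReal
        ((sampleLossConst p.ρ + (8 * p.α * Real.posLog (p.T * δ ^ 2 / N) + 34)) / δ ^ 2) := by
  have := h.isProbabilityMeasure
  have hL : 0 ≤ Real.posLog (p.T * δ ^ 2 / N) := Real.posLog_nonneg
  rw [add_div, ENNReal.ofReal_add (div_nonneg (sampleLossConst_nonneg hρ hρ') (sq_nonneg δ))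
    (by positivity)]
  refine (h.lintegral_indicator_latePlays_le hp hmax hρ s i _).trans (add_le_add ?_ ?_)
  · refine le_trans (sum_le_sum fun k _ => lintegral_mono fun ω => iSup₂_mono fun n hn => ?_)
      (sum_lintegral_iSup_gaussOdds_le hρ hρ' (h.measurable_sub_mean s)
        (h.iIndepFun_sub_mean s) (h.hasSubgaussianMGF_sub_mean s) hδ p.T)
    have hn0 : n ≠ 0 := by have := mem_Ioc.1 hn; omega
    have hmean := empMean_sub_const (x := fun j => X s j ω) (mean ν s) hn0
    rw [empMean] at hmean
    rw [sampleOdds, hmean]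
    exact (congrArg (fun w => gaussOdds (√(p.ρ * n) * w)) (by ring)).le
  · refine le_trans (sum_le_sum fun k _ => measure_mono ?_)
      (sum_measure_exists_lt_clipLevel_le (h.measurable_sub_mean i) (h.iIndepFun_sub_mean i)
        (h.hasSubgaussianMGF_sub_mean i) hα i.pos hδ)
    rintro ω ⟨n, hn, hlt⟩
    have hn0 : n ≠ 0 := by have := mem_Ioc.1 hn; omega
    refine ⟨n, hn, ?_⟩
    rw [clipLevel_sub_const (x := fun j => X i j ω) _ hn0]
    linarith

end Regret

section Minimax

variable {N : ℕ}

/-- A bound for the regret per round caused by clipping levels of arm `s`, whose mean is `m`, that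
fall by `2 ^ j * d` below `m` for some `j`. -/
noncomputable def levelLoss (p : Params N) (s : Fin N) (m d : ℝ) (q : Input N) : ℝ≥0∞ :=
  ∑' j : ℕ, (levelsAbove p s (m - 2 ^ j * d))ᶜ.indicator
    (fun _ => ENNReal.ofReal (2 ^ (j + 2) * d)) q

lemma measurable_levelLoss (p : Params N) (s : Fin N) (m d : ℝ) :
    Measurable (levelLoss p s m d) :=
  Measurable.tsum fun _ => measurable_const.indicator (measurableSet_levelsAbove p s _).compl

lemma antitone_levelsAbove (p : Params N) (s : Fin N) : Antitone (levelsAbove p s) :=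
  fun _ _ hy _ hq n hn => hy.trans_lt (hq n hn)

lemma ofReal_le_levelLoss {p : Params N} {s : Fin N} {m d g : ℝ} {q : Input N} (hd : 0 < d)
    (hg : 2 * d ≤ g) (hq : q ∉ levelsAbove p s (m - g / 2)) :
    ENNReal.ofReal g ≤ levelLoss p s m d q := by
  have hratio : 1 ≤ g / (2 * d) := by rwa [one_le_div (by positivity)]
  obtain ⟨j, hj, hj'⟩ := exists_nat_pow_near hratio (one_lt_two : (1 : ℝ) < 2)
  rw [le_div_iff₀ (by positivity)] at hj
  rw [div_lt_iff₀ (by positivity)] at hj'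
  have hmem : q ∈ (levelsAbove p s (m - 2 ^ j * d))ᶜ := fun hmem =>
    hq (antitone_levelsAbove p s (by linarith) hmem)
  calc ENNReal.ofReal g ≤ ENNReal.ofReal (2 ^ (j + 2) * d) :=
        ENNReal.ofReal_le_ofReal (hj'.le.trans_eq (by ring))
    _ = (levelsAbove p s (m - 2 ^ j * d))ᶜ.indicator
          (fun _ => ENNReal.ofReal (2 ^ (j + 2) * d)) q := by rw [Set.indicator_of_mem hmem]
    _ ≤ levelLoss p s m d q := ENNReal.le_tsum j

lemma sum_ofReal_gap_arm_le (p : Params N) (ν : Fin N → Measure ℝ) (s : Fin N) (m : ℝ) {d : ℝ}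
    (hd : 0 < d) (q : Input N) :
    ∑ t ∈ Ico N p.T, ENNReal.ofReal (gap ν (arm p q.1 q.2 t)) ≤
      p.T * (ENNReal.ofReal (2 * d) + levelLoss p s m d q) +
      ∑ a with 2 * d ≤ gap ν a, ENNReal.ofReal (gap ν a) *
        (levelsAbove p s (m - gap ν a / 2)).indicator (latePlays p a) q := by
  have hround : ∀ t, ENNReal.ofReal (gap ν (arm p q.1 q.2 t)) ≤
      (ENNReal.ofReal (2 * d) + levelLoss p s m d q) +
      ∑ a with 2 * d ≤ gap ν a, ENNReal.ofReal (gap ν a) *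
        (levelsAbove p s (m - gap ν a / 2)).indicator
          ({q | arm p q.1 q.2 t = a}.indicator 1) q := by
    intro t
    set b := arm p q.1 q.2 t with hb
    rcases lt_or_ge (gap ν b) (2 * d) with hsmall | hbig
    · rw [add_assoc]
      exact (ENNReal.ofReal_le_ofReal hsmall.le).trans le_self_add
    by_cases hq : q ∈ levelsAbove p s (m - gap ν b / 2)
    · refine le_add_left (le_trans (le_of_eq ?_)
        (single_le_sum (fun _ _ => zero_le) (mem_filter.2 ⟨mem_univ b, hbig⟩)))
      simp [Set.indicator_of_mem hq, ← hb]
    · exact le_add_right (le_add_left (ofReal_le_levelLoss hd hbig hq))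
  refine (sum_le_sum fun t _ => hround t).trans ?_
  rw [sum_add_distrib, sum_comm]
  refine add_le_add ?_ (le_of_eq (sum_congr rfl fun a _ => ?_))
  · rw [sum_const, nsmul_eq_mul]
    gcongr
    simp
  · rw [← mul_sum]
    congr 1
    by_cases hq : q ∈ levelsAbove p s (m - gap ν a / 2) <;> simp [hq, latePlays]

variable {p : Params N} {Ω : Type*} [MeasurableSpace Ω] {P : Measure Ω} {ν : Fin N → Measure ℝ}
  {X : Fin N → ℕ → Ω → ℝ} {Z : ℕ → Fin N → Ω → ℝ}

lemma IsModel.lintegral_levelLoss_le (h : IsModel P ν X Z) (hα : 4 ≤ p.α) (hT : 0 < p.T)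
    (s : Fin N) {d : ℝ} (hd : 0 < d) (hNT : (N : ℝ) = p.T * d ^ 2) :
    ∫⁻ ω, levelLoss p s (mean ν s) d (input X Z ω) ∂P ≤ ENNReal.ofReal (192 * d) := by
  have : (0 : ℝ) < p.T := Nat.cast_pos.2 hT
  set fail : ℕ → Set (Input N) := fun j => (levelsAbove p s (mean ν s - 2 ^ j * d))ᶜ
  have hfail : ∀ j, MeasurableSet (fail j) := fun j => (measurableSet_levelsAbove p s _).compl
  have hterm : ∀ j, ∫⁻ ω, (fail j).indicator (fun _ => ENNReal.ofReal (2 ^ (j + 2) * d))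
      (input X Z ω) ∂P ≤ ENNReal.ofReal (96 * d * (1 / 2) ^ j) := by
    intro j
    calc _ = ENNReal.ofReal (2 ^ (j + 2) * d) * P (input X Z ⁻¹' fail j) :=
          lintegral_indicator_const (h.measurable_input (hfail j)) _
      _ ≤ ENNReal.ofReal (2 ^ (j + 2) * d) *
            ENNReal.ofReal (24 * N / (p.T * (2 ^ j * d) ^ 2)) := by
          gcongr
          exact h.measure_compl_levelsAbove_le hα hT s (by positivity)
      _ = _ := by
          rw [← ENNReal.ofReal_mul (by positivity), hNT, pow_add, one_div, inv_pow]
          congr 1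
          field_simp
          norm_num
  refine (lintegral_tsum fun j =>
    ((measurable_const.indicator (hfail j)).comp h.measurable_input).aemeasurable).trans_le
      ((ENNReal.tsum_le_tsum hterm).trans ?_)
  rw [← ENNReal.ofReal_tsum_of_nonneg (fun j => by positivity) (summable_geometric_two.mul_left _),
    tsum_mul_left, tsum_geometric_two]
  exact ENNReal.ofReal_le_ofReal (by linarith)

/-- The constant in the bound for the regret caused by a single arm. -/
noncomputable def armLossConst (ρ α : ℝ) : ℝ := 2 * (sampleLossConst ρ + 34) + 32 * α

lemma armLossConst_nonneg {ρ α : ℝ} (hρ : 0 < ρ) (hρ' : ρ < 1) (hα : 0 ≤ α) :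
    0 ≤ armLossConst ρ α := by
  have := sampleLossConst_nonneg hρ hρ'
  unfold armLossConst
  positivity

lemma gap_mul_bound_le {C α N T d g : ℝ} (hC : 0 ≤ C) (hα : 0 ≤ α) (hT : 0 < T) (hd : 0 < d)
    (hNT : N = T * d ^ 2) (hg : 2 * d ≤ g) :
    g * ((C + (8 * α * Real.posLog (T * (g / 2) ^ 2 / N) + 34)) / (g / 2) ^ 2) ≤
      (2 * (C + 34) + 32 * α) / d := by
  obtain ⟨δ, rfl⟩ : ∃ δ, g = 2 * δ := ⟨g / 2, by ring⟩
  rw [mul_div_cancel_left₀ δ two_ne_zero]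
  have hdδ : d ≤ δ := by linarith
  have hδ : 0 < δ := hd.trans_le hdδ
  have hlog : Real.posLog (T * δ ^ 2 / N) ≤ 2 * (δ / d) := by
    have hsq : T * δ ^ 2 / N = (δ / d) ^ 2 := by rw [hNT]; field_simp
    rw [hsq, Real.posLog_pow, Nat.cast_ofNat]
    gcongr
    exact max_le (by positivity) (Real.log_le_self (by positivity))
  calc 2 * δ * ((C + (8 * α * Real.posLog (T * δ ^ 2 / N) + 34)) / δ ^ 2)
      ≤ 2 * δ * ((C + (8 * α * (2 * (δ / d)) + 34)) / δ ^ 2) := by gcongr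
    _ = 2 * (C + 34) / δ + 32 * α / d := by field_simp; ring
    _ ≤ 2 * (C + 34) / d + 32 * α / d := by gcongr
    _ = _ := (add_div _ _ _).symm

lemma IsModel.sum_gap_mul_lintegral_latePlays_le (h : IsModel P ν X Z) (hp : Measurable p.argmax)
    (hmax : ∀ (θ : Fin N → ℝ) b, θ b ≤ θ (p.argmax θ)) (hρ : 0 < p.ρ) (hρ' : p.ρ < 1)
    (hα : 0 ≤ p.α) (hT : 0 < p.T) {s : Fin N} (hs : ∀ a, gap ν a = mean ν s - mean ν a) {d : ℝ}
    (hd : 0 < d) (hNT : (N : ℝ) = p.T * d ^ 2) :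
    ∑ a with 2 * d ≤ gap ν a, ENNReal.ofReal (gap ν a) *
        ∫⁻ ω, (levelsAbove p s (mean ν s - gap ν a / 2)).indicator (latePlays p a)
          (input X Z ω) ∂P ≤
      ENNReal.ofReal (p.T * (armLossConst p.ρ p.α * d)) := by
  have harm : ∀ a ∈ univ.filter fun a => 2 * d ≤ gap ν a, ENNReal.ofReal (gap ν a) *
      ∫⁻ ω, (levelsAbove p s (mean ν s - gap ν a / 2)).indicator (latePlays p a)
        (input X Z ω) ∂P ≤ ENNReal.ofReal (armLossConst p.ρ p.α / d) := by
    intro a ha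
    have hbig : 2 * d ≤ gap ν a := (mem_filter.1 ha).2
    refine (mul_le_mul_right (h.lintegral_indicator_latePlays_le_ofReal hp hmax hρ hρ' hα
      (by linarith) (by rw [← hs a]; ring)) _).trans ?_
    rw [← ENNReal.ofReal_mul (gap_nonneg ν a)]
    exact ENNReal.ofReal_le_ofReal (gap_mul_bound_le (sampleLossConst_nonneg hρ hρ') hα
      (Nat.cast_pos.2 hT) hd hNT hbig)
  have hcard : #(univ.filter fun a => 2 * d ≤ gap ν a) ≤ N :=
    (card_filter_le _ _).trans_eq (by simp)
  calc _ ≤ #(univ.filter fun a => 2 * d ≤ gap ν a) • ENNReal.ofReal (armLossConst p.ρ p.α / d) :=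
        sum_le_card_nsmul _ _ _ harm
    _ ≤ N • ENNReal.ofReal (armLossConst p.ρ p.α / d) := by gcongr
    _ = ENNReal.ofReal (p.T * (armLossConst p.ρ p.α * d)) := by
        rw [← ENNReal.ofReal_nsmul, nsmul_eq_mul, hNT]
        congr 1
        field_simp

/-- The factor of `√(N T)` in the bound for the expected regret. -/
noncomputable def minimaxConst (ρ α : ℝ) : ℝ := 194 + armLossConst ρ α

lemma minimaxConst_nonneg {ρ α : ℝ} (hρ : 0 < ρ) (hρ' : ρ < 1) (hα : 0 ≤ α) :
    0 ≤ minimaxConst ρ α :=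
  add_nonneg (by norm_num) (armLossConst_nonneg hρ hρ' hα)

lemma IsModel.lintegral_regret_le (h : IsModel P ν X Z) (hp : Measurable p.argmax)
    (hmax : ∀ (θ : Fin N → ℝ) b, θ b ≤ θ (p.argmax θ)) (hρ : 0 < p.ρ) (hρ' : p.ρ < 1)
    (hα : 4 ≤ p.α) (hT : 0 < p.T) :
    ∫⁻ ω, ENNReal.ofReal (regret p ν (input X Z ω).1 (input X Z ω).2) ∂P ≤
      ENNReal.ofReal (∑ a, gap ν a + minimaxConst p.ρ p.α * √(N * p.T)) := by
  have := h.isProbabilityMeasure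
  have hN : 0 < N := (p.argmax 0).pos
  have : Nonempty (Fin N) := ⟨p.argmax 0⟩
  obtain ⟨s, hs⟩ := exists_gap_eq_mean_sub_mean ν
  have hα0 : 0 ≤ p.α := by linarith
  have hA := armLossConst_nonneg hρ hρ' hα0
  have hG : 0 ≤ ∑ a, gap ν a := sum_nonneg fun a _ => gap_nonneg ν a
  set d := √(N / p.T) with hd
  have hd0 : 0 < d := by positivity
  have hNT : (N : ℝ) = p.T * d ^ 2 := by rw [hd, Real.sq_sqrt (by positivity)]; field_simp
  have hTd : √(N * p.T) = p.T * d := by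
    rw [hNT, show p.T * d ^ 2 * p.T = (p.T * d) ^ 2 by ring, Real.sqrt_sq (by positivity)]
  have hlate : ∀ a, Measurable fun ω => (levelsAbove p s (mean ν s - gap ν a / 2)).indicator
      (latePlays p a) (input X Z ω) := fun a =>
    ((measurable_latePlays hp a).indicator (measurableSet_levelsAbove p s _)).comp
      h.measurable_input
  have hloss : Measurable fun ω => levelLoss p s (mean ν s) d (input X Z ω) :=
    (measurable_levelLoss p s _ d).comp h.measurable_input
  calc _ ≤ ∫⁻ ω, (∑ a, ENNReal.ofReal (gap ν a) +
          (p.T * (ENNReal.ofReal (2 * d) + levelLoss p s (mean ν s) d (input X Z ω)) +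
          ∑ a with 2 * d ≤ gap ν a, ENNReal.ofReal (gap ν a) *
            (levelsAbove p s (mean ν s - gap ν a / 2)).indicator (latePlays p a)
              (input X Z ω))) ∂P := lintegral_mono fun ω => (ofReal_regret_le p ν _).trans <| by
        gcongr
        exact sum_ofReal_gap_arm_le p ν s _ hd0 _
    _ = ∑ a, ENNReal.ofReal (gap ν a) + (p.T * (ENNReal.ofReal (2 * d) +
          ∫⁻ ω, levelLoss p s (mean ν s) d (input X Z ω) ∂P) +
          ∑ a with 2 * d ≤ gap ν a, ENNReal.ofReal (gap ν a) *
            ∫⁻ ω, (levelsAbove p s (mean ν s - gap ν a / 2)).indicator (latePlays p a)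
              (input X Z ω) ∂P) := by
        rw [lintegral_add_left measurable_const, lintegral_const, measure_univ, mul_one,
          lintegral_add_left (by fun_prop), lintegral_const_mul _ (by fun_prop),
          lintegral_add_left measurable_const, lintegral_const, measure_univ, mul_one,
          lintegral_finsetSum _ fun a _ => (hlate a).const_mul _]
        simp only [lintegral_const_mul _ (hlate _)]
    _ ≤ ENNReal.ofReal (∑ a, gap ν a) + (ENNReal.ofReal p.T *
          (ENNReal.ofReal (2 * d) + ENNReal.ofReal (192 * d)) +
          ENNReal.ofReal (p.T * (armLossConst p.ρ p.α * d))) := by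
        rw [ENNReal.ofReal_sum_of_nonneg fun a _ => gap_nonneg ν a, ENNReal.ofReal_natCast]
        gcongr
        · exact h.lintegral_levelLoss_le hα hT s hd0 hNT
        · exact h.sum_gap_mul_lintegral_latePlays_le hp hmax hρ hρ' hα0 hT hs hd0 hNT
    _ = _ := by
        rw [← ENNReal.ofReal_add (by positivity) (by positivity),
          ← ENNReal.ofReal_mul (by positivity),
          ← ENNReal.ofReal_add (by positivity) (by positivity),
          ← ENNReal.ofReal_add hG (by positivity), minimaxConst, hTd]
        congr 1
        ring

lemma IsModel.integral_regret_le (h : IsModel P ν X Z) (hp : Measurable p.argmax)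
    (hmax : ∀ (θ : Fin N → ℝ) b, θ b ≤ θ (p.argmax θ)) (hρ : 0 < p.ρ) (hρ' : p.ρ < 1)
    (hα : 4 ≤ p.α) :
    ∫ ω, regret p ν (input X Z ω).1 (input X Z ω).2 ∂P ≤
      ∑ a, gap ν a + minimaxConst p.ρ p.α * √(N * p.T) := by
  have hbound : 0 ≤ ∑ a, gap ν a + minimaxConst p.ρ p.α * √(N * p.T) :=
    add_nonneg (sum_nonneg fun a _ => gap_nonneg ν a)
      (mul_nonneg (minimaxConst_nonneg hρ hρ' (by linarith)) (Real.sqrt_nonneg _))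
  rcases Nat.eq_zero_or_pos p.T with hT | hT
  · simpa [regret, hT] using hbound
  · rw [integral_eq_lintegral_of_nonneg_ae (ae_of_all _ fun ω => regret_nonneg _ _ _ _)
      (h.integrable_regret hp).aestronglyMeasurable]
    exact ENNReal.toReal_le_of_le_ofReal hbound (h.lintegral_regret_le hp hmax hρ hρ' hα hT)

lemma IsModel.integral_regret_le_of_gap_le_one (h : IsModel P ν X Z) (hp : Measurable p.argmax)
    (hmax : ∀ (θ : Fin N → ℝ) b, θ b ≤ θ (p.argmax θ)) (hρ : 0 < p.ρ) (hρ' : p.ρ < 1)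
    (hα : 4 ≤ p.α) (hgap : ∀ a, gap ν a ≤ 1) :
    ∫ ω, regret p ν (input X Z ω).1 (input X Z ω).2 ∂P ≤
      (1 + minimaxConst p.ρ p.α) * √(N * p.T) := by
  have := h.isProbabilityMeasure
  rcases le_total N p.T with hNT | hTN
  · have hsum : ∑ a, gap ν a ≤ √(N * p.T) :=
      calc ∑ a, gap ν a ≤ N := (sum_le_card_nsmul _ _ 1 fun a _ => hgap a).trans_eq (by simp)
        _ = √(N * N) := (Real.sqrt_mul_self N.cast_nonneg).symm
        _ ≤ √(N * p.T) := by gcongr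
    linarith [h.integral_regret_le hp hmax hρ hρ' hα]
  · calc ∫ ω, regret p ν (input X Z ω).1 (input X Z ω).2 ∂P
        ≤ ∫ _, (p.T : ℝ) ∂P := integral_mono (h.integrable_regret hp) (integrable_const _)
          fun ω => (regret_le p hgap _ _).trans_eq (mul_one _)
      _ = √(p.T * p.T) := by simp
      _ ≤ √(N * p.T) := by gcongr
      _ ≤ (1 + minimaxConst p.ρ p.α) * √(N * p.T) := le_mul_of_one_le_left (Real.sqrt_nonneg _)
          (le_add_of_nonneg_right (minimaxConst_nonneg hρ hρ' (by linarith)))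

end Minimax

end BMOTS

theorem mainTheorem1_general {ρ α : ℝ} (hρ : 0 < ρ) (hρ' : ρ < 1) (hα : 4 ≤ α) :
    ∃ C : ℝ, ∀ (N : ℕ) (p : BMOTS.Params N), p.ρ = ρ → p.α = α →
      Measurable p.argmax → (∀ (θ : Fin N → ℝ) (b : Fin N), θ b ≤ θ (p.argmax θ)) →
      ∀ {Ω : Type*} [MeasurableSpace Ω] (P : Measure Ω) (ν : Fin N → Measure ℝ)
        (X : Fin N → ℕ → Ω → ℝ) (Z : ℕ → Fin N → Ω → ℝ), BMOTS.IsModel P ν X Z →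
        Integrable (fun ω => BMOTS.regret p ν (fun a i => X a i ω) (fun t a => Z t a ω)) P ∧
        ∫ ω, BMOTS.regret p ν (fun a i => X a i ω) (fun t a => Z t a ω) ∂P
            ≤ C * (√((N : ℝ) * p.T) + ∑ a, BMOTS.gap ν a) ∧
        ((∀ a, BMOTS.gap ν a ≤ 1) →
          ∫ ω, BMOTS.regret p ν (fun a i => X a i ω) (fun t a => Z t a ω) ∂P
            ≤ C * √((N : ℝ) * p.T)) ∧
        ∀ ω, (BMOTS.state p (fun a i => X a i ω) (fun t a => Z t a ω) p.T).batches
            ≤ N * (Nat.log 2 p.T + 1) := by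
  refine ⟨1 + BMOTS.minimaxConst ρ α, ?_⟩
  rintro N p rfl rfl hp hmax Ω _ P ν X Z h
  refine ⟨h.integrable_regret hp, (h.integral_regret_le hp hmax hρ hρ' hα).trans ?_,
    h.integral_regret_le_of_gap_le_one hp hmax hρ hρ' hα, fun ω => BMOTS.batches_le _ _ _ _⟩
  have hK := BMOTS.minimaxConst_nonneg hρ hρ' (by linarith : 0 ≤ p.α)
  have hgap : 0 ≤ ∑ a, BMOTS.gap ν a := sum_nonneg fun a _ => BMOTS.gap_nonneg ν a
  linarith [mul_nonneg hK hgap, Real.sqrt_nonneg ((N : ℝ) * p.T)]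

theorem mainTheorem1 (ρ α : ℝ) (hρ : 1 / 2 < ρ) (hρ' : ρ < 1) (hα : 4 ≤ α) :
    ∃ C : ℝ, ∀ (N : ℕ) (p : BMOTS.Params N), 0 < N → p.ρ = ρ → p.α = α →
      Measurable p.argmax → (∀ (θ : Fin N → ℝ) (b : Fin N), θ b ≤ θ (p.argmax θ)) →
      ∀ {Ω : Type*} [MeasurableSpace Ω] (P : Measure Ω) [IsProbabilityMeasure P]
        (ν : Fin N → Measure ℝ) [∀ a, IsProbabilityMeasure (ν a)]
        (X : Fin N → ℕ → Ω → ℝ) (Z : ℕ → Fin N → Ω → ℝ), BMOTS.IsModel P ν X Z →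
        Integrable (fun ω => BMOTS.regret p ν (fun a i => X a i ω) (fun t a => Z t a ω)) P ∧
        ∫ ω, BMOTS.regret p ν (fun a i => X a i ω) (fun t a => Z t a ω) ∂P
            ≤ C * (√((N : ℝ) * p.T) + ∑ a, BMOTS.gap ν a) ∧
        ((∀ a, BMOTS.gap ν a ≤ 1) →
          ∫ ω, BMOTS.regret p ν (fun a i => X a i ω) (fun t a => Z t a ω) ∂P
            ≤ C * √((N : ℝ) * p.T)) ∧
        ∀ ω, (BMOTS.state p (fun a i => X a i ω) (fun t a => Z t a ω) p.T).batches
            ≤ N * (Nat.log 2 p.T + 1) := by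
  obtain ⟨C, hC⟩ := mainTheorem1_general (by linarith : 0 < ρ) hρ' hα
  exact ⟨C, fun N p _ hpρ hpα hp hmax Ω _ P _ ν _ X Z h => hC N p hpρ hpα hp hmax P ν X Z h⟩
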